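/- Let $r\ge 1$, let $P\in\mathbf{C}[X_1,\dots,X_r]$ be a reduced (that is, square-free) polynomial, and let $\mathcal{H}=\{z\in\mathbf{C}^r : P(z)=0\}$ be the hypersurface it defines. Let $X=X_{i_0}$ be one of the indeterminates, let $Y=(X_i)_{i\neq i_0}$ denote the others, and let $P_X\in\mathbf{C}[Y][X]$ be $P$ viewed as a polynomial in $X$ with coefficients in $\mathbf{C}[Y]$. Let $\operatorname{Disc}(P_X)\in\mathbf{C}[Y]$ be the resultant, with respect to $X$, of the derivative $P'_X=\partial P_X/\partial X$ and $P_X$. For $y\in\mathbf{C}^{r-1}$ let $L_y\subset\mathbf{C}^r$ be the line of direction $X$ consisting of the points whose $Y$-coordinates are $y$; it is called generic with respect to $\mathcal{H}$ if $\operatorname{Disc}(P_X)(y)\neq 0$. Assume that the coefficients of $P_X$ are all together coprime in $\mathbf{C}[Y]$, i.e. that their only common divisors are the nonzero constants. Let $L=L_y$ be a line of direction $X$ which is generic with respect to $\mathcal{H}$. Then the inclusion $L-L\cap\mathcal{H}\hookrightarrow\mathbf{C}^r-\mathcal{H}$ is $\pi_1$-surjective: for every base point $x_0\in L-L\cap\mathcal{H}$,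 the induced homomorphism $\pi_1(L-L\cap\mathcal{H},x_0)\to\pi_1(\mathbf{C}^r-\mathcal{H},x_0)$ is surjective. -/

import Mathlib

namespace ZariskiPi1

/-- The indices of the variables `Y = (X_i)_{i ≠ i₀}`. -/
abbrev YIndex {r : ℕ} (i₀ : Fin r) : Type := {j : Fin r // j ≠ i₀}

/-- `P_X`: the polynomial `P ∈ ℂ[X_1, …, X_r]` viewed as a polynomial in the single
variable `X = X_{i₀}`, with coefficients in the polynomial ring `ℂ[Y]` in the others. -/
noncomputable def polyInX {r : ℕ} (i₀ : Fin r) (P : MvPolynomial (Fin r) ℂ) :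
    Polynomial (MvPolynomial (YIndex i₀) ℂ) :=
  MvPolynomial.aeval
    (fun j : Fin r =>
      if h : j = i₀ then (Polynomial.X : Polynomial (MvPolynomial (YIndex i₀) ℂ))
      else Polynomial.C (MvPolynomial.X ⟨j, h⟩)) P

/-- `Disc(P_X) ∈ ℂ[Y]`: the resultant of `P'_X` and `P_X`, formed with the actual degrees
of these two polynomials in `X`. -/
noncomputable def discX {r : ℕ} (i₀ : Fin r) (P : MvPolynomial (Fin r) ℂ) :
    MvPolynomial (YIndex i₀) ℂ :=
  Polynomial.resultant (Polynomial.derivative (polyInX i₀ P)) (polyInX i₀ P)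

/-- The coefficients of `P_X` are all together coprime: their only common divisors in `ℂ[Y]`
are the units. -/
def CoeffsCoprime {r : ℕ} (i₀ : Fin r) (P : MvPolynomial (Fin r) ℂ) : Prop :=
  ∀ d : MvPolynomial (YIndex i₀) ℂ, (∀ k : ℕ, d ∣ (polyInX i₀ P).coeff k) → IsUnit d

/-- The hypersurface of `ℂ^r` defined by `P`. -/
def hypersurface {r : ℕ} (P : MvPolynomial (Fin r) ℂ) : Set (Fin r → ℂ) :=
  {z | MvPolynomial.eval z P = 0}

/-- The projection `p : ℂ^r → ℂ^{r-1}`, `(x, y) ↦ y`, forgetting the coordinate `X_{i₀}`. -/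
def projY {r : ℕ} (i₀ : Fin r) (z : Fin r → ℂ) : YIndex i₀ → ℂ :=
  fun j => z j

/-- The line `L_y = p⁻¹(y)` of direction `X`; all the lines of direction `X` are of this form. -/
def lineX {r : ℕ} (i₀ : Fin r) (y : YIndex i₀ → ℂ) : Set (Fin r → ℂ) :=
  projY i₀ ⁻¹' {y}

/-- `L_y` is generic with respect to the hypersurface of `P`: `Disc(P_X)(y) ≠ 0`. -/
def IsGenericLine {r : ℕ} (i₀ : Fin r) (P : MvPolynomial (Fin r) ℂ) (y : YIndex i₀ → ℂ) : Prop :=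
  MvPolynomial.eval y (discX i₀ P) ≠ 0

/-- `f` is `π₁`-surjective: it induces a surjection of fundamental groups at every base point
of its source. -/
def PiOneSurjective {A B : Type*} [TopologicalSpace A] [TopologicalSpace B] (f : C(A, B)) : Prop :=
  ∀ a : A, Function.Surjective (FundamentalGroup.map f a)

theorem diff_inter_subset_compl {α : Type*} (L H : Set α) : L \ (L ∩ H) ⊆ Hᶜ :=
  fun _ hz hH => hz.2 ⟨hz.1, hH⟩

/-- The inclusion `L - L ∩ H ↪ ℂ^r - H`, for the subspace topologies. -/
noncomputable def complInclusion {r : ℕ} (L H : Set (Fin r → ℂ)) :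
    C((L \ (L ∩ H) : Set (Fin r → ℂ)), (Hᶜ : Set (Fin r → ℂ))) :=
  ContinuousMap.inclusion (diff_inter_subset_compl L H)

end ZariskiPi1

namespace ZariskiPi1

open Set Topology

/-! Let `K` be the image of π₁(L − H). The inclusion of L − H lifts to the covering of ℂ^r − H
attached to `K`. If this lift extends to a global section, every loop of ℂ^r − H lifts to a closed
loop, hence lies in `K` (`piOneSurjective_of_sections`). So it suffices that every section of a
covering over a generic fibre extends globally.

Where the discriminant D is nonzero, the roots in X are simple and constant in number, so the family
of punctured lines is locally trivial and sections extend locally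
(`hasExtensionsNear_of_simple_zeros`). Over a convex open W above which some horizontal slice X = c
misses H, there is no monodromy: the slice lifts uniquely through a given point because W is simply
connected, and the fibres are connected, so the lifted slice determines the section on each fibre.
The section then crosses D = 0, because removing the zeros of a polynomial disconnects no small ball
(`exists_extend_section_of_slice`).

Such a slice exists near every base point whose line is not contained in H. The excluded points are
the common zeros of the coefficients; by coprimality, generic segments from y₀ avoid them
(`exists_forall_line_ne_zero`). Extending along these segments gives sections over convex
neighbourhoods that all contain y₀; they therefore agree on overlaps, and their union extends across
the remaining directions Q = 0 (`exists_extend_section_of_star`). -/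

/-- A set `U` in which any two paths with the same endpoints are homotopic in the ambient space. -/
def HomotopicPathsIn {X : Type*} [TopologicalSpace X] (U : Set X) : Prop :=
  ∀ ⦃y z : X⦄ (p q : Path y z), range p ⊆ U → range q ⊆ U → p.Homotopic q

/-! ### Coverings attached to subgroups, and a criterion for π₁-surjectivity -/

section Covering

universe u

variable {X : Type u} [TopologicalSpace X]

open unitInterval
open Path.Homotopic (Quotient)
open Path.Homotopic.Quotient

theorem symm_trans_eq {x y z : X} (p : Quotient x y) (q : Quotient y z) :
    (p.trans q).symm = q.symm.trans p.symm := by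
  induction p using Path.Homotopic.Quotient.ind with | mk p =>
  induction q using Path.Homotopic.Quotient.ind with | mk q =>
  rw [← mk_trans, ← mk_symm, ← mk_symm, ← mk_symm, ← mk_trans, Path.trans_symm]

theorem trans_trans_symm_trans {x y z w : X} (p : Quotient x z) (q : Quotient y z)
    (r : Quotient z w) : (p.trans r).trans (q.trans r).symm = p.trans q.symm := by
  rw [symm_trans_eq, trans_assoc, ← trans_assoc r, trans_symm, refl_trans]

/-- Choose, for each member `U i` of a cover, path classes from `x₀` to the points of `U i` that are
transported to each other by the paths inside `U i`. -/
theorem exists_path_system [PathConnectedSpace X] (x₀ : X) (U : X → Set X)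
    (hpc : ∀ i, IsPathConnected (U i)) (hU : ∀ i, HomotopicPathsIn (U i)) (hi : ∀ i, i ∈ U i) :
    ∃ b : ∀ _i x : X, Quotient x₀ x, ∀ (i x x' : X) (p : Path x x'), range p ⊆ U i →
      b i x' = (b i x).trans (mk p) := by
  classical
  refine ⟨fun i x => if h : x ∈ U i then
    (mk (PathConnectedSpace.somePath x₀ i)).trans (mk ((hpc i).joinedIn i (hi i) x h).somePath)
    else mk (PathConnectedSpace.somePath x₀ x), fun i x x' p hp => ?_⟩
  have hx : x ∈ U i := hp ⟨0, p.source⟩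
  have hx' : x' ∈ U i := hp ⟨1, p.target⟩
  beta_reduce
  rw [dif_pos hx, dif_pos hx', trans_assoc, ← mk_trans (JoinedIn.somePath _) p]
  congr 1
  refine Path.Homotopic.Quotient.eq.2 (hU i _ _ ?_ ?_)
  · rintro _ ⟨t, rfl⟩
    exact JoinedIn.somePath_mem _ t
  · rw [Path.trans_range]
    refine union_subset ?_ hp
    rintro _ ⟨t, rfl⟩
    exact JoinedIn.somePath_mem _ t

/-- The fibre bundle core of the covering space attached to a subgroup `K` of the fundamental
group, for a system of path classes as in `exists_path_system`. -/
noncomputable def coveringCore [LocallyPathConnectedSpace X] {x₀ : X}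
    (K : Subgroup (FundamentalGroup X x₀)) [TopologicalSpace (FundamentalGroup X x₀ ⧸ K)]
    [DiscreteTopology (FundamentalGroup X x₀ ⧸ K)]
    (U : X → Set X) (hUo : ∀ i, IsOpen (U i)) (hi : ∀ i, i ∈ U i) (b : ∀ _i x : X, Quotient x₀ x)
    (hb : ∀ (i x x' : X) (p : Path x x'), range p ⊆ U i → b i x' = (b i x).trans (mk p)) :
    FiberBundleCore X X (FundamentalGroup X x₀ ⧸ K) where
  baseSet := U
  isOpen_baseSet := hUo
  indexAt := id
  mem_baseSet_at := hi
  coordChange i j x v := FundamentalGroup.fromPath ((b i x).trans (b j x).symm) • v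
  coordChange_self i x _ v := by
    rw [trans_symm]
    exact one_smul _ v
  continuousOn_coordChange i j := by
    rintro ⟨x, v⟩ ⟨⟨hxi, hxj⟩, -⟩
    apply ContinuousAt.continuousWithinAt
    obtain ⟨W, ⟨hW, hWpc⟩, hWU⟩ := (path_connected_basis x).mem_iff.1
      (((hUo i).inter (hUo j)).mem_nhds ⟨hxi, hxj⟩)
    have : ∀ᶠ q : X × (FundamentalGroup X x₀ ⧸ K) in 𝓝 (x, v),
        FundamentalGroup.fromPath ((b i x).trans (b j x).symm) • v =
        FundamentalGroup.fromPath ((b i q.1).trans (b j q.1).symm) • q.2 := by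
      rw [nhds_prod_eq, nhds_discrete (FundamentalGroup X x₀ ⧸ K), Filter.prod_pure,
        Filter.eventually_map]
      filter_upwards [hW] with x' hx'
      have hJ := hWpc.joinedIn x (mem_of_mem_nhds hW) x' hx'
      have hr : range hJ.somePath ⊆ W := by
        rintro _ ⟨t, rfl⟩
        exact hJ.somePath_mem t
      rw [hb i x x' hJ.somePath (hr.trans (hWU.trans inter_subset_left)),
        hb j x x' hJ.somePath (hr.trans (hWU.trans inter_subset_right))]
      rw [trans_trans_symm_trans]
    exact (continuousAt_const (y := FundamentalGroup.fromPath ((b i x).trans (b j x).symm) • v)).congr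
      this
  coordChange_comp i j k x _ v := by
    rw [smul_smul]
    congr 1
    -- Multiplication in the fundamental group composes loops from right to left, so the loop for
    -- `i, j` comes first here. This is why the group acts on left cosets.
    change Path.Homotopic.Quotient.trans _ _ = _
    rw [trans_assoc, ← trans_assoc (b j x).symm, symm_trans, refl_trans]

/-- The point over the endpoint of `p` in the covering space attached to `K`. -/
noncomputable def coveringPoint {x₀ : X} (K : Subgroup (FundamentalGroup X x₀))
    (b : ∀ _i x : X, Quotient x₀ x) {x : X} (p : Quotient x₀ x) : FundamentalGroup X x₀ ⧸ K :=
  QuotientGroup.mk (FundamentalGroup.fromPath (p.trans (b x x).symm))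

/-- In the bundle with fibre G/K, the lift of a loop γ from the base point `e` ends at the point
defined by the class of γ. It is therefore closed exactly when that class lies in `K`. -/
theorem exists_covering_of_subgroup [PathConnectedSpace X] [LocallyPathConnectedSpace X]
    (hX : ∀ x : X, ∃ U : Set X, IsOpen U ∧ x ∈ U ∧ IsPathConnected U ∧ HomotopicPathsIn U)
    {x₀ : X} (K : Subgroup (FundamentalGroup X x₀)) :
    ∃ (Y : Type u) (_ : TopologicalSpace Y) (π : Y → X) (hπ : IsCoveringMap π) (e : Y)
      (he : π e = x₀), (FundamentalGroup.mapOfEq ⟨π, hπ.continuous⟩ he).range = K := by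
  choose U hUo hi hpc hU using hX
  obtain ⟨b, hb⟩ := exists_path_system x₀ U hpc hU hi
  let _ : TopologicalSpace (FundamentalGroup X x₀ ⧸ K) := ⊥
  have : DiscreteTopology (FundamentalGroup X x₀ ⧸ K) := ⟨rfl⟩
  let Z := coveringCore K U hUo hi b hb
  have hπ : IsCoveringMap Z.proj := FiberBundle.isCoveringMap
  let e : Z.TotalSpace := ⟨x₀, coveringPoint K b (refl x₀)⟩
  let P (x : X) (p : Quotient x₀ x) : Z.TotalSpace := ⟨x, coveringPoint K b p⟩
  have hP : ∀ {x y : X} (h : y = x) (p : Quotient x₀ x), P x p = P y (p.cast rfl h) := by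
    rintro x _ rfl p
    rw [cast_rfl_rfl]
  have hlift : ∀ γ : Path x₀ x₀, hπ.liftPath γ e γ.source 1 = P x₀ (mk γ) := by
    intro γ
    -- The lift is explicit: over `γ t` sits the point given by γ restricted to [0, t]. Its
    -- coordinate in the chart at `γ t` is locally constant, and uniqueness of lifts identifies it.
    let c (t : I) : Path x₀ (γ t) := (γ.subpath 0 t).cast γ.source.symm rfl
    have hc : ∀ t t' : I, mk (c t') = (mk (c t)).trans (mk (γ.subpath t t')) := by
      intro t t'
      have h : Path.Homotopic _ _ := ⟨Path.Homotopy.subpathTransSubpath γ 0 t t'⟩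
      rw [← mk_trans, Path.Homotopic.Quotient.eq]
      exact (h.pathCast γ.source.symm rfl).symm
    have hΓ : (fun t => P (γ t) (mk (c t))) = hπ.liftPath γ e γ.source := by
      refine (hπ.eq_liftPath_iff _).2 ⟨?_, rfl, ?_⟩
      · refine continuous_iff_continuousAt.2 fun t => ?_
        refine (FiberBundle.continuousAt_totalSpace _ _).2 ⟨γ.continuous.continuousAt, ?_⟩
        refine (continuousAt_const (y := QuotientGroup.mk (s := K) (FundamentalGroup.fromPath
          ((mk (c t)).trans (b (γ t) (γ t)).symm)))).congr ?_
        have hW : ∀ᶠ t' in 𝓝 t, γ '' uIcc t t' ⊆ U (γ t) := by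
          obtain ⟨l, r, htl, hn, hlr⟩ := exists_Icc_mem_subset_of_mem_nhds
            (((hUo (γ t)).preimage γ.continuous).mem_nhds (hi (γ t)))
          filter_upwards [hn] with t' ht'
          exact image_subset_iff.2 ((uIcc_subset_Icc htl ht').trans hlr)
        filter_upwards [hW] with t' ht'
        rw [← γ.range_subpath] at ht'
        change _ = FundamentalGroup.fromPath ((b (γ t') (γ t')).trans (b (γ t) (γ t')).symm) •
          QuotientGroup.mk (s := K) (FundamentalGroup.fromPath
            ((mk (c t')).trans (b (γ t') (γ t')).symm))
        refine congrArg (QuotientGroup.mk (s := K)) ?_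
        change _ = ((mk (c t')).trans (b (γ t') (γ t')).symm).trans
          ((b (γ t') (γ t')).trans (b (γ t) (γ t')).symm)
        rw [trans_assoc, ← trans_assoc (b (γ t') (γ t')).symm, symm_trans, refl_trans, hc t t',
          hb (γ t) (γ t) (γ t') _ ht', trans_trans_symm_trans]
      · rw [hP γ.source.symm]
        refine congrArg (P x₀) ?_
        rw [← mk_cast, ← mk_refl]
        congr 1
        ext s
        simp [c, Path.subpath]
    rw [← hΓ]
    change P (γ 1) _ = _
    rw [hP γ.target.symm, ← mk_cast]
    congr 2
    ext s
    simp [c, Path.subpath]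
  have hiff : ∀ γ : Path x₀ x₀, hπ.liftPath γ e γ.source 1 = e ↔
      FundamentalGroup.fromPath (mk γ) ∈ K := by
    intro γ
    rw [hlift]
    have h1 : P x₀ (mk γ) = e ↔ coveringPoint K b (mk γ) = coveringPoint K b (refl x₀) :=
      Bundle.TotalSpace.mk_inj
    have h2 : ∀ p : Quotient x₀ x₀, coveringPoint K b p = QuotientGroup.mk (s := K)
        (FundamentalGroup.fromPath (b x₀ x₀).symm * FundamentalGroup.fromPath p) := fun p => rfl
    rw [h1, h2, h2, eq_comm, QuotientGroup.eq]
    have h3 : FundamentalGroup.fromPath (refl x₀) = 1 := rfl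
    rw [h3, mul_one, inv_mul_cancel_left]
  refine ⟨Z.TotalSpace, inferInstance, Z.proj, hπ, e, rfl, le_antisymm ?_ ?_⟩
  · rintro _ ⟨δ, rfl⟩
    induction δ using Path.Homotopic.Quotient.ind with | mk δ =>
    rw [FundamentalGroup.mapOfEq_apply]
    change FundamentalGroup.fromPath (mk (δ.map hπ.continuous)) ∈ K
    rw [← hiff, ← (hπ.eq_liftPath_iff _).2 ⟨δ.continuous, rfl, δ.source⟩]
    exact δ.target
  · intro g hg
    induction g using Path.Homotopic.Quotient.ind with | mk γ =>
    have h1 := (hiff γ).2 hg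
    refine ⟨FundamentalGroup.fromPath (mk ⟨hπ.liftPath γ e γ.source, hπ.liftPath_zero .., h1⟩), ?_⟩
    rw [FundamentalGroup.mapOfEq_apply]
    refine congrArg (mk (x₀ := x₀) (x₁ := x₀)) (Path.ext ?_)
    exact hπ.liftPath_lifts γ e γ.source

/-- A map all of whose lifts to covering spaces of the target extend to sections is surjective
on fundamental groups. -/
theorem piOneSurjective_of_sections {A : Type*} [TopologicalSpace A] [PathConnectedSpace A]
    [LocallyPathConnectedSpace A] [PathConnectedSpace X] [LocallyPathConnectedSpace X]
    (hX : ∀ x : X, ∃ U : Set X, IsOpen U ∧ x ∈ U ∧ IsPathConnected U ∧ HomotopicPathsIn U)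
    (f : C(A, X))
    (h : ∀ (Y : Type u) [TopologicalSpace Y] (π : Y → X), IsCoveringMap π → ∀ s₀ : C(A, Y),
      (∀ a, π (s₀ a) = f a) → ∃ s : C(X, Y), (∀ x, π (s x) = x) ∧ ∀ a, s (f a) = s₀ a) :
    PiOneSurjective f := by
  intro a g
  obtain ⟨Y, _, π, hπ, e, he, hK⟩ := exists_covering_of_subgroup hX (FundamentalGroup.map f a).range
  obtain ⟨s₀, ⟨h0, hs₀⟩, -⟩ := hπ.existsUnique_continuousMap_lifts_of_range_le he hK.ge
  obtain ⟨s, hs, hsf⟩ := h Y π hπ s₀ (congrFun hs₀)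
  have hse : s (f a) = e := (hsf a).trans h0
  subst hse
  change g ∈ (FundamentalGroup.map f a).range
  rw [← hK]
  induction g using Path.Homotopic.Quotient.ind with | mk γ =>
  refine ⟨FundamentalGroup.fromPath (mk (γ.map s.continuous)), ?_⟩
  rw [FundamentalGroup.mapOfEq_apply]
  refine congrArg (mk (x₀ := f a) (x₁ := f a)) (Path.ext ?_)
  exact funext fun t => hs (γ t)

end Covering

/-! ### Functions polynomial on complex lines: connectedness off the zeros -/

section LinePoly

variable {V : Type*} [NormedAddCommGroup V] [NormedSpace ℂ V]

/-- The restriction of `f` to every complex line is a polynomial function. -/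
def IsLinePoly (f : V → ℂ) : Prop :=
  ∀ a v : V, ∃ g : Polynomial ℂ, ∀ t : ℂ, f (a + t • v) = g.eval t

theorem IsLinePoly.const (c : ℂ) : IsLinePoly fun _ : V => c :=
  fun _ _ => ⟨Polynomial.C c, fun _ => by simp⟩

theorem IsLinePoly.add {f g : V → ℂ} (hf : IsLinePoly f) (hg : IsLinePoly g) :
    IsLinePoly fun x => f x + g x := by
  intro a v
  obtain ⟨p, hp⟩ := hf a v
  obtain ⟨q, hq⟩ := hg a v
  exact ⟨p + q, fun t => by simp [hp, hq]⟩

theorem IsLinePoly.mul {f g : V → ℂ} (hf : IsLinePoly f) (hg : IsLinePoly g) :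
    IsLinePoly fun x => f x * g x := by
  intro a v
  obtain ⟨p, hp⟩ := hf a v
  obtain ⟨q, hq⟩ := hg a v
  exact ⟨p * q, fun t => by simp [hp, hq]⟩

theorem IsLinePoly.pow {f : V → ℂ} (hf : IsLinePoly f) (n : ℕ) : IsLinePoly fun x => f x ^ n := by
  intro a v
  obtain ⟨p, hp⟩ := hf a v
  exact ⟨p ^ n, fun t => by simp [hp]⟩

theorem IsLinePoly.linear (l : V →ₗ[ℂ] ℂ) : IsLinePoly fun x => l x := by
  intro a v
  exact ⟨Polynomial.C (l a) + Polynomial.C (l v) * Polynomial.X, fun t => by simp [mul_comm (l v)]⟩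

theorem IsLinePoly.comp_linear {W : Type*} [NormedAddCommGroup W] [NormedSpace ℂ W] {f : W → ℂ}
    (hf : IsLinePoly f) (l : V →ₗ[ℂ] W) : IsLinePoly fun x => f (l x) := by
  intro a v
  obtain ⟨p, hp⟩ := hf (l a) (l v)
  exact ⟨p, fun t => by simp [hp]⟩

theorem IsLinePoly.comp_add_right {f : V → ℂ} (hf : IsLinePoly f) (c : V) :
    IsLinePoly fun x => f (x + c) := by
  intro a v
  obtain ⟨p, hp⟩ := hf (a + c) v
  exact ⟨p, fun t => by rw [← hp, add_right_comm]⟩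

/-- On the complex line from a point of `U` through `b`, the function is a nonzero polynomial with
finitely many roots, while `U` cuts out an infinite set of parameters. -/
theorem IsLinePoly.exists_ne_zero {f : V → ℂ} (hf : IsLinePoly f) {b : V} (hb : f b ≠ 0)
    {U : Set V} (hU : IsOpen U) (hne : U.Nonempty) : (U ∩ {x | f x ≠ 0}).Nonempty := by
  obtain ⟨x, hx⟩ := hne
  obtain ⟨g, hg⟩ := hf x (b - x)
  have hg0 : g ≠ 0 := by
    rintro rfl
    have := hg 1
    simp at this
    exact hb this
  have hc : Continuous fun t : ℂ => x + t • (b - x) := by fun_prop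
  have hn : (fun t : ℂ => x + t • (b - x)) ⁻¹' U ∈ 𝓝 (0 : ℂ) :=
    hc.continuousAt.preimage_mem_nhds (hU.mem_nhds (by simpa using hx))
  obtain ⟨t, htU, ht⟩ := ((infinite_of_mem_nhds 0 hn).sdiff g.roots.toFinset.finite_toSet).nonempty
  refine ⟨_, htU, ?_⟩
  rw [mem_ofPred_eq, hg]
  intro h0
  exact ht (by simpa [hg0] using h0)

/-- The complex line through `a` and `b` contains finitely many zeros, which are avoided by bending
the real segment into an arc with parameter t + i·l·t(1 − t), for small l > 0. -/
theorem IsLinePoly.joinedIn [NormedSpace ℝ V] [IsScalarTower ℝ ℂ V] {f : V → ℂ}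
    (hf : IsLinePoly f) {U : Set V} (hU : IsOpen U) (hc : Convex ℝ U) {a b : V}
    (haU : a ∈ U) (hbU : b ∈ U) (ha : f a ≠ 0) (hb : f b ≠ 0) :
    JoinedIn (U ∩ {x | f x ≠ 0}) a b := by
  obtain ⟨g, hg⟩ := hf a (b - a)
  have hg0 : g.eval 0 ≠ 0 := by rw [← hg]; simpa using ha
  have hg1 : g.eval 1 ≠ 0 := by rw [← hg]; simpa using hb
  have hgne : g ≠ 0 := by rintro rfl; simp at hg0
  let k : ℝ × ℝ → V := fun q => a + ((q.1 : ℂ) + q.2 * Complex.I) • (b - a)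
  have hk : Continuous k := by fun_prop
  have hseg : Icc (0 : ℝ) 1 ×ˢ {(0 : ℝ)} ⊆ k ⁻¹' U := by
    rintro ⟨t, μ⟩ ⟨ht, rfl⟩
    have : k (t, 0) = a + t • (b - a) := by
      simp only [k, Complex.ofReal_zero, zero_mul, add_zero]
      rw [← Complex.coe_algebraMap, algebraMap_smul]
    rw [mem_preimage, this]
    exact hc.add_smul_sub_mem haU hbU ht
  obtain ⟨A, B, -, hB, hA, h0B, hAB⟩ := generalized_tube_lemma isCompact_Icc isCompact_singleton
    (hU.preimage hk) hseg
  obtain ⟨ε, hε, hεB⟩ := Metric.isOpen_iff.1 hB 0 (h0B rfl)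
  -- A root w can lie on the interior of the arc only for l = Im w / (Re w (1 − Re w)), so finitely
  -- many values of l are excluded.
  obtain ⟨l, hl, hlg⟩ := ((Ioo_infinite hε).sdiff
    (g.roots.toFinset.finite_toSet.image fun w : ℂ => w.im / (w.re * (1 - w.re)))).nonempty
  refine JoinedIn.ofLine (f := fun t => k (t, l * (t * (1 - t))))
    (hk.comp (by fun_prop)).continuousOn (by simp [k]) (by simp [k]) ?_
  rintro _ ⟨t, ht, rfl⟩
  refine ⟨hAB ⟨hA ht, hεB ?_⟩, ?_⟩
  · rw [mem_ball_zero_iff, Real.norm_eq_abs, abs_of_nonneg]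
    · have h1 : t * (1 - t) ≤ 1 := by nlinarith [ht.1, ht.2]
      nlinarith [hl.1, hl.2]
    · exact mul_nonneg hl.1.le (mul_nonneg ht.1 (by linarith [ht.2]))
  · change f (a + _) ≠ 0
    rw [hg]
    intro h0
    rcases eq_or_ne t 0 with rfl | ht0
    · exact hg0 (by simpa using h0)
    rcases eq_or_ne t 1 with rfl | ht1
    · exact hg1 (by simpa using h0)
    refine hlg ⟨_, by simpa [hgne] using h0, ?_⟩
    have : t * (1 - t) ≠ 0 := mul_ne_zero ht0 (sub_ne_zero.2 (Ne.symm ht1))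
    simp
    field_simp

theorem IsLinePoly.isPreconnected [NormedSpace ℝ V] [IsScalarTower ℝ ℂ V] {f : V → ℂ}
    (hf : IsLinePoly f) {U : Set V} (hU : IsOpen U) (hc : Convex ℝ U) :
    IsPreconnected (U ∩ {x | f x ≠ 0}) :=
  isPreconnected_of_forall_pair fun a ha b hb => by
    obtain ⟨γ, hγ⟩ := hf.joinedIn hU hc ha.1 hb.1 ha.2 hb.2
    exact ⟨range γ, range_subset_iff.2 hγ, ⟨0, γ.source⟩, ⟨1, γ.target⟩,
      isPreconnected_range γ.continuous⟩

end LinePoly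

/-! ### Sections of coverings: gluing and extension across zero sets -/

section Sections

/-- `s` is a continuous section over `A` of the map `π` to the subspace `O` of `V`. -/
def IsSectionOn {V Y : Type*} [TopologicalSpace V] [TopologicalSpace Y] {O : Set V} (π : Y → O)
    (s : V → Y) (A : Set V) : Prop :=
  ContinuousOn s A ∧ ∀ x ∈ A, (π (s x) : V) = x

variable {V Y : Type*} [TopologicalSpace Y]

section Topological

variable [TopologicalSpace V] {O : Set V} {π : Y → O} {s s' : V → Y} {A B : Set V}

theorem IsSectionOn.mono (h : IsSectionOn π s A) (hBA : B ⊆ A) : IsSectionOn π s B :=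
  ⟨h.1.mono hBA, fun x hx => h.2 x (hBA hx)⟩

theorem IsSectionOn.eqOn (hπ : IsCoveringMap π) (h : IsSectionOn π s A) (h' : IsSectionOn π s' A)
    (hA : IsPreconnected A) {x : V} (hx : x ∈ A) (hs : s x = s' x) : EqOn s s' A :=
  hπ.eqOn_of_comp_eqOn hA h.1 h'.1
    (fun z hz => Subtype.ext ((h.2 z hz).trans (h'.2 z hz).symm)) hx hs

theorem exists_glue_sections [Nonempty Y] {ι : Type*} (A : ι → Set V) (hA : ∀ i, IsOpen (A i))
    (s : ι → V → Y) (hs : ∀ i, IsSectionOn π (s i) (A i))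
    (h : ∀ i j, EqOn (s i) (s j) (A i ∩ A j)) :
    ∃ t : V → Y, IsSectionOn π t (⋃ i, A i) ∧ ∀ i, EqOn t (s i) (A i) := by
  classical
  let t : V → Y := fun x => if hx : ∃ i, x ∈ A i then s hx.choose x else Classical.arbitrary Y
  have ht : ∀ i, EqOn t (s i) (A i) := by
    intro i x hx
    have hx' : ∃ i, x ∈ A i := ⟨i, hx⟩
    simp only [t, dif_pos hx']
    exact h _ _ ⟨hx'.choose_spec, hx⟩
  refine ⟨t, ⟨fun x hx => ?_, fun x hx => ?_⟩, ht⟩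
  · obtain ⟨i, hi⟩ := mem_iUnion.1 hx
    exact (((hs i).1.congr (ht i)).continuousAt ((hA i).mem_nhds hi)).continuousWithinAt
  · obtain ⟨i, hi⟩ := mem_iUnion.1 hx
    rw [ht i hi, (hs i).2 x hi]

theorem exists_glue_two_sections [Nonempty Y] (hA : IsOpen A) (hB : IsOpen B)
    (hs : IsSectionOn π s A) (hs' : IsSectionOn π s' B) (h : EqOn s s' (A ∩ B)) :
    ∃ t : V → Y, IsSectionOn π t (A ∪ B) ∧ EqOn t s A ∧ EqOn t s' B := by
  obtain ⟨t, ht, h'⟩ := exists_glue_sections (π := π) (fun b : Bool => cond b A B)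
    (by rintro (_ | _) <;> assumption) (fun b => cond b s s') (by rintro (_ | _) <;> assumption)
    (by
      rintro (_ | _) (_ | _)
      · exact fun _ _ => rfl
      · exact fun x hx => (h ⟨hx.2, hx.1⟩).symm
      · exact h
      · exact fun _ _ => rfl)
  rw [← union_eq_iUnion] at ht
  exact ⟨t, ht, h' true, h' false⟩

/-- One evenly covered neighbourhood serves every `e` above it: the section is the sheet through
`e`. -/
theorem exists_section_nhds (hO : IsOpen O) (hπ : IsCoveringMap π) {x : V} (hx : x ∈ O) :
    ∃ W ∈ 𝓝 x, ∀ e : Y, (π e : V) ∈ W → ∃ s, IsSectionOn π s W ∧ s (π e) = e := by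
  obtain ⟨-, U, hxU, hU, -, H, hH⟩ := hπ ⟨x, hx⟩
  refine ⟨(↑) '' U, (hO.isOpenMap_subtype_val U hU).mem_nhds ⟨_, hxU, rfl⟩, fun e he => ?_⟩
  have heU : π e ∈ U := by
    obtain ⟨u, hu, hue⟩ := he
    rwa [← Subtype.ext hue]
  have hW : ∀ z ∈ ((↑) '' U : Set V), ∃ hz : z ∈ O, ⟨z, hz⟩ ∈ U := by
    rintro _ ⟨u, hu, rfl⟩
    exact ⟨u.2, hu⟩
  classical
  let s : V → Y := fun z => if hz : ∃ hz : z ∈ O, ⟨z, hz⟩ ∈ U then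
    (H.symm (⟨⟨z, hz.choose⟩, hz.choose_spec⟩, (H ⟨e, heU⟩).2) : Y) else e
  have hs : ∀ (z : V) (hz : z ∈ O) (hzU : ⟨z, hz⟩ ∈ U),
      s z = H.symm (⟨⟨z, hz⟩, hzU⟩, (H ⟨e, heU⟩).2) := fun z hz hzU => dif_pos ⟨hz, hzU⟩
  refine ⟨s, ⟨?_, ?_⟩, ?_⟩
  · rw [continuousOn_iff_continuous_domRestrict]
    have : ((↑) '' U : Set V).domRestrict s = fun z : ((↑) '' U : Set V) =>
        (H.symm (⟨⟨z, (hW z z.2).choose⟩, (hW z z.2).choose_spec⟩, (H ⟨e, heU⟩).2) : Y) :=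
      funext fun z => hs z _ (hW z z.2).choose_spec
    rw [this]
    fun_prop
  · intro z hz
    obtain ⟨hzO, hzU⟩ := hW z hz
    rw [hs z hzO hzU, ← hH, H.apply_symm_apply]
  · rw [hs (π e) (π e).2 heU]
    have : ((⟨⟨π e, (π e).2⟩, heU⟩ : U), (H ⟨e, heU⟩).2) = H ⟨e, heU⟩ :=
      Prod.ext (Subtype.ext (hH ⟨e, heU⟩).symm) rfl
    rw [this, H.symm_apply_apply]

end Topological

variable [NormedAddCommGroup V] [NormedSpace ℂ V] [NormedSpace ℝ V] [IsScalarTower ℝ ℂ V]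

/-- A section defined off the zero set of a nonzero function that is polynomial on lines
extends across this zero set. -/
theorem exists_extend_section [Nonempty Y] {O : Set V} {π : Y → O} (hO : IsOpen O)
    (hπ : IsCoveringMap π) {f : V → ℂ} (hf : IsLinePoly f) {b : V} (hb : f b ≠ 0) {A : Set V}
    (hA : IsOpen A) (hAO : A ⊆ O) {s : V → Y} (hs : IsSectionOn π s (A ∩ {x | f x ≠ 0})) :
    ∃ t : V → Y, IsSectionOn π t A ∧ EqOn t s (A ∩ {x | f x ≠ 0}) := by
  have hloc : ∀ x : A, ∃ (ε : ℝ) (σ : V → Y), 0 < ε ∧ Metric.ball (x : V) ε ⊆ A ∧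
      IsSectionOn π σ (Metric.ball x ε) ∧ EqOn σ s (Metric.ball x ε ∩ {x | f x ≠ 0}) := by
    intro x
    obtain ⟨W, hW, hWs⟩ := exists_section_nhds hO hπ (hAO x.2)
    obtain ⟨ε, hε, hεW⟩ := Metric.mem_nhds_iff.1 (Filter.inter_mem hW (hA.mem_nhds x.2))
    -- The ball minus the zeros of `f` is nonempty and connected, so the sheet through a single
    -- value of `s` agrees with `s` on all of it.
    obtain ⟨z, hz, hfz⟩ := hf.exists_ne_zero hb Metric.isOpen_ball ⟨_, Metric.mem_ball_self hε⟩
    have hz' : (π (s z) : V) = z := hs.2 z ⟨(hεW hz).2, hfz⟩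
    obtain ⟨σ, hσ, hσz⟩ := hWs (s z) (by rw [hz']; exact (hεW hz).1)
    rw [hz'] at hσz
    have hσ' : IsSectionOn π σ (Metric.ball x ε) := hσ.mono (hεW.trans inter_subset_left)
    refine ⟨ε, σ, hε, hεW.trans inter_subset_right, hσ', ?_⟩
    exact (hσ'.mono inter_subset_left).eqOn hπ
      (hs.mono (inter_subset_inter_left _ (hεW.trans inter_subset_right)))
      (hf.isPreconnected Metric.isOpen_ball (convex_ball _ _)) ⟨hz, hfz⟩ hσz
  choose ε σ hε hεA hσ hσs using hloc
  obtain ⟨t, ht, htσ⟩ := exists_glue_sections (fun x : A => Metric.ball (x : V) (ε x))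
    (fun _ => Metric.isOpen_ball) σ hσ (by
      rintro x y z hz
      obtain ⟨w, hw, hfw⟩ := hf.exists_ne_zero hb (Metric.isOpen_ball.inter Metric.isOpen_ball)
        ⟨z, hz⟩
      exact ((hσ x).mono inter_subset_left).eqOn hπ ((hσ y).mono inter_subset_right)
        ((convex_ball _ _).inter (convex_ball _ _)).isPreconnected hw
        ((hσs x ⟨hw.1, hfw⟩).trans (hσs y ⟨hw.2, hfw⟩).symm) hz)
  refine ⟨t, ht.mono fun x hx => mem_iUnion.2 ⟨⟨x, hx⟩, Metric.mem_ball_self (hε _)⟩, ?_⟩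
  rintro x ⟨hx, hfx⟩
  rw [htσ ⟨x, hx⟩ (Metric.mem_ball_self (hε _)), hσs ⟨x, hx⟩ ⟨Metric.mem_ball_self (hε _), hfx⟩]

end Sections

/-! ### Extension over a convex open set with a horizontal slice off the zeros -/

section Fibration

variable {B Y : Type*} [TopologicalSpace Y]

/-- The part of the complement of the zero set of `F` lying over `W`. -/
def tube (F : ℂ × B → ℂ) (W : Set B) : Set (ℂ × B) := Prod.snd ⁻¹' W ∩ {x | F x ≠ 0}

theorem tube_mono {F : ℂ × B → ℂ} {W W' : Set B} (h : W ⊆ W') : tube F W ⊆ tube F W' :=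
  inter_subset_inter_left _ (preimage_mono h)

variable [NormedAddCommGroup B]

theorem isOpen_tube {F : ℂ × B → ℂ} (hF : Continuous F) {W : Set B} (hW : IsOpen W) :
    IsOpen (tube F W) :=
  (hW.preimage continuous_snd).inter (isOpen_ne_fun hF continuous_const)

theorem exists_lift_slice [NormedSpace ℝ B] {F : ℂ × B → ℂ} {π : Y → {x | F x ≠ 0}}
    (hπ : IsCoveringMap π) {c : ℂ}
    {W : Set B} (hW : IsOpen W) (hWc : Convex ℝ W) (hc : ∀ w ∈ W, F (c, w) ≠ 0) {y : B}
    (hy : y ∈ W) {e : Y} (he : (π e : ℂ × B) = (c, y)) :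
    ∃ τ : B → Y, ContinuousOn τ W ∧ (∀ w ∈ W, (π (τ w) : ℂ × B) = (c, w)) ∧ τ y = e := by
  have : ContractibleSpace W := hWc.contractibleSpace ⟨y, hy⟩
  have : LocallyPathConnectedSpace W := hW.locallyPathConnectedSpace
  let f : C(W, {x | F x ≠ 0}) := ⟨fun w => ⟨(c, w), hc w w.2⟩, by fun_prop⟩
  obtain ⟨τ, ⟨h0, hτ⟩, -⟩ := hπ.existsUnique_continuousMap_lifts f ⟨y, hy⟩ e (Subtype.ext he)
  classical
  have hτ' : ∀ (w : B) (hw : w ∈ W),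
      (fun w => if hw : w ∈ W then τ ⟨w, hw⟩ else e) w = τ ⟨w, hw⟩ := fun w hw => dif_pos hw
  refine ⟨fun w => if hw : w ∈ W then τ ⟨w, hw⟩ else e, ?_, fun w hw => ?_, ?_⟩
  · rw [continuousOn_iff_continuous_domRestrict]
    exact τ.continuous.congr fun w => (hτ' w w.2).symm
  · rw [hτ' w hw]
    exact congrArg Subtype.val (congrFun hτ ⟨w, hw⟩)
  · rw [hτ' y hy, h0]

/-- Sections over fibres near `y` extend to a tube around the fibre over `y`. -/
def HasExtensionsNear (F : ℂ × B → ℂ) (π : Y → {x | F x ≠ 0}) (y : B) : Prop :=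
  ∃ ε > 0, ∀ y' ∈ Metric.ball y ε, ∀ s, IsSectionOn π s (tube F {y'}) →
    ∃ t, IsSectionOn π t (tube F (Metric.ball y ε)) ∧ EqOn t s (tube F {y'})

theorem HasExtensionsNear.exists_le {F : ℂ × B → ℂ} {π : Y → {x | F x ≠ 0}} {y : B}
    (h : HasExtensionsNear F π y) {U : Set B} (hU : U ∈ 𝓝 y) :
    ∃ ε > 0, Metric.ball y ε ⊆ U ∧ ∀ y' ∈ Metric.ball y ε, ∀ s, IsSectionOn π s (tube F {y'}) →
      ∃ t, IsSectionOn π t (tube F (Metric.ball y ε)) ∧ EqOn t s (tube F {y'}) := by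
  obtain ⟨ε, hε, h⟩ := h
  obtain ⟨δ, hδ, hδU⟩ := Metric.mem_nhds_iff.1 hU
  have hl := Metric.ball_subset_ball (x := y) (min_le_left ε δ)
  refine ⟨min ε δ, lt_min hε hδ, (Metric.ball_subset_ball (min_le_right _ _)).trans hδU, ?_⟩
  intro y' hy' s hs
  obtain ⟨t, ht, hts⟩ := h y' (hl hy') s hs
  exact ⟨t, ht.mono (tube_mono hl), hts⟩

variable [NormedSpace ℂ B]

theorem isPreconnected_tube_singleton {F : ℂ × B → ℂ} (hF : IsLinePoly F) (y : B) :
    IsPreconnected (tube F {y}) := by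
  have hF' : IsLinePoly fun z : ℂ => F (z, y) := by
    intro a v
    obtain ⟨p, hp⟩ := hF (a, y) (v, 0)
    exact ⟨p, fun t => by rw [← hp]; simp⟩
  have h := (hF'.isPreconnected isOpen_univ convex_univ).image (fun z : ℂ => (z, y))
    (by fun_prop)
  convert h using 1
  ext ⟨z, w⟩
  constructor
  · rintro ⟨rfl, hz⟩
    exact ⟨z, ⟨mem_univ _, hz⟩, rfl⟩
  · rintro ⟨z', ⟨-, hz⟩, h⟩
    cases h
    exact ⟨rfl, hz⟩

variable [NormedSpace ℝ B] [IsScalarTower ℝ ℂ B]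

theorem isPreconnected_tube {F : ℂ × B → ℂ} (hF : IsLinePoly F) {W : Set B} (hW : IsOpen W)
    (hWc : Convex ℝ W) : IsPreconnected (tube F W) :=
  hF.isPreconnected (hW.preimage continuous_snd) (hWc.linear_preimage (LinearMap.snd ℝ ℂ B))

/-- A section over a generic fibre extends over any convex open set `W` of the base above which
some horizontal slice avoids the zero set of `F`. -/
theorem exists_extend_section_of_slice [Nonempty Y] {F : ℂ × B → ℂ} (hF : IsLinePoly F)
    (hFc : Continuous F) {π : Y → {x | F x ≠ 0}} (hπ : IsCoveringMap π) {D : B → ℂ}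
    (hD : IsLinePoly D) (hDc : Continuous D) (hE : ∀ y, D y ≠ 0 → HasExtensionsNear F π y) {c : ℂ}
    {W : Set B} (hW : IsOpen W) (hWc : Convex ℝ W) (hc : ∀ w ∈ W, F (c, w) ≠ 0) {y : B}
    (hy : y ∈ W) (hDy : D y ≠ 0) {s : ℂ × B → Y} (hs : IsSectionOn π s (tube F {y})) :
    ∃ t, IsSectionOn π t (tube F W) ∧ EqOn t s (tube F {y}) := by
  have hO : IsOpen {x | F x ≠ 0} := isOpen_ne_fun hFc continuous_const
  have hmem : ∀ {U : Set B} {w : B}, w ∈ U → w ∈ W → (c, w) ∈ tube F U :=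
    fun hwU hw => ⟨hwU, hc _ hw⟩
  -- The lifted slice `τ` normalises all continuations: a section over a fibre is determined by its
  -- value at height `c`, so requiring this value to be `τ` removes monodromy.
  obtain ⟨τ, hτc, hτ, hτy⟩ := exists_lift_slice hπ hW hWc hc hy (hs.2 _ (hmem rfl hy))
  have hS : IsOpen (W ∩ {x | D x ≠ 0}) := hW.inter (isOpen_ne_fun hDc continuous_const)
  choose! ε hε hεS hext using fun w (hw : w ∈ W ∩ {x | D x ≠ 0}) =>
    (hE w hw.2).exists_le (hS.mem_nhds hw)
  let G : B → Prop := fun w => ∃ s, IsSectionOn π s (tube F {w}) ∧ s (c, w) = τ w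
  have hG : ∀ w ∈ W ∩ {x | D x ≠ 0}, ∀ w' ∈ Metric.ball w (ε w), G w' →
      ∃ t, IsSectionOn π t (tube F (Metric.ball w (ε w))) ∧
        ∀ z ∈ Metric.ball w (ε w), t (c, z) = τ z := by
    rintro w hw w' hw' ⟨s', hs', hs'τ⟩
    obtain ⟨t, ht, hts⟩ := hext w hw w' hw' s' hs'
    have hbW : Metric.ball w (ε w) ⊆ W := (hεS w hw).trans inter_subset_left
    refine ⟨t, ht, hπ.eqOn_of_comp_eqOn (convex_ball w (ε w)).isPreconnected
      (ht.1.comp (by fun_prop) fun z hz => hmem hz (hbW hz)) (hτc.mono hbW) ?_ hw' ?_⟩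
    · intro z hz
      exact Subtype.ext ((ht.2 _ (hmem hz (hbW hz))).trans (hτ z (hbW hz)).symm)
    · exact (hts (hmem rfl (hbW hw'))).trans hs'τ
  have hGrestrict : ∀ {w z t}, z ∈ Metric.ball w (ε w) →
      IsSectionOn π t (tube F (Metric.ball w (ε w))) → t (c, z) = τ z → G z :=
    fun hz ht htz => ⟨_, ht.mono (tube_mono (singleton_subset_iff.2 hz)), htz⟩
  -- `G` spreads through each ball from any of its points, so the balls around good and bad centres
  -- cannot meet. The connectedness of W ∩ {D ≠ 0} leaves no bad centre.
  have hGall : ∀ w ∈ W ∩ {x | D x ≠ 0}, G w := by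
    by_contra! hne
    obtain ⟨w₀, hw₀, hGw₀⟩ := hne
    obtain ⟨z, -, hz1, hz2⟩ := hD.isPreconnected hW hWc
      (⋃ w ∈ {w ∈ W ∩ {x | D x ≠ 0} | G w}, Metric.ball w (ε w))
      (⋃ w ∈ {w ∈ W ∩ {x | D x ≠ 0} | ¬ G w}, Metric.ball w (ε w))
      (isOpen_biUnion fun _ _ => Metric.isOpen_ball) (isOpen_biUnion fun _ _ => Metric.isOpen_ball)
      (by
        intro w hw
        by_cases hGw : G w
        · exact Or.inl (mem_biUnion (⟨hw, hGw⟩ : w ∈ {w ∈ W ∩ {x | D x ≠ 0} | G w})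
            (Metric.mem_ball_self (hε w hw)))
        · exact Or.inr (mem_biUnion (⟨hw, hGw⟩ : w ∈ {w ∈ W ∩ {x | D x ≠ 0} | ¬ G w})
            (Metric.mem_ball_self (hε w hw))))
      ⟨y, ⟨hy, hDy⟩, mem_biUnion (⟨⟨hy, hDy⟩, s, hs, hτy.symm⟩ :
        y ∈ {w ∈ W ∩ {x | D x ≠ 0} | G w}) (Metric.mem_ball_self (hε y ⟨hy, hDy⟩))⟩
      ⟨w₀, hw₀, mem_biUnion (⟨hw₀, hGw₀⟩ : w₀ ∈ {w ∈ W ∩ {x | D x ≠ 0} | ¬ G w})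
        (Metric.mem_ball_self (hε w₀ hw₀))⟩
    simp only [mem_iUnion] at hz1 hz2
    obtain ⟨w₁, ⟨hw₁, hG₁⟩, hz1⟩ := hz1
    obtain ⟨w₂, ⟨hw₂, hG₂⟩, hz2⟩ := hz2
    obtain ⟨t, ht, htτ⟩ := hG w₁ hw₁ w₁ (Metric.mem_ball_self (hε w₁ hw₁)) hG₁
    obtain ⟨t', ht', htτ'⟩ := hG w₂ hw₂ z hz2 (hGrestrict hz1 ht (htτ z hz1))
    have hw₂' := Metric.mem_ball_self (x := w₂) (hε w₂ hw₂)
    exact hG₂ (hGrestrict hw₂' ht' (htτ' w₂ hw₂'))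
  choose t ht htτ using fun w : ↥(W ∩ {x | D x ≠ 0}) =>
    hG w w.2 w (Metric.mem_ball_self (hε w w.2)) (hGall w w.2)
  obtain ⟨u, hu, hut⟩ := exists_glue_sections
    (fun w : ↥(W ∩ {x | D x ≠ 0}) => tube F (Metric.ball w (ε w)))
    (fun w => isOpen_tube hFc Metric.isOpen_ball) t ht (by
      rintro w w' ⟨z, x⟩ ⟨h, h'⟩
      have hx : x ∈ W := (hεS w w.2 h.1).1
      refine ((ht w).mono (tube_mono (singleton_subset_iff.2 h.1))).eqOn hπ
        ((ht w').mono (tube_mono (singleton_subset_iff.2 h'.1)))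
        (isPreconnected_tube_singleton hF x) (hmem rfl hx) ?_ ⟨rfl, h.2⟩
      rw [htτ w x h.1, htτ w' x h'.1])
  have hball : ∀ w (hw : w ∈ W ∩ {x | D x ≠ 0}), w ∈ Metric.ball w (ε w) :=
    fun w hw => Metric.mem_ball_self (hε w hw)
  obtain ⟨v, hv, hvu⟩ := exists_extend_section hO hπ (hD.comp_linear (LinearMap.snd ℂ ℂ B))
    (b := (0, y)) hDy (isOpen_tube hFc hW) inter_subset_right (s := u) (hu.mono (by
      rintro ⟨z, x⟩ ⟨⟨hx, hz⟩, hDx⟩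
      exact mem_iUnion.2 ⟨⟨x, hx, hDx⟩, hball x ⟨hx, hDx⟩, hz⟩))
  refine ⟨v, hv, (hv.mono (tube_mono (singleton_subset_iff.2 hy))).eqOn hπ hs
    (isPreconnected_tube_singleton hF y) (hmem rfl hy) ?_⟩
  rw [hvu ⟨hmem hy hy, hDy⟩, hut ⟨y, hy, hDy⟩ (hmem (hball y ⟨hy, hDy⟩) hy),
    htτ ⟨y, hy, hDy⟩ y (hball y ⟨hy, hDy⟩), hτy]

end Fibration

/-! ### Extension along segments and gluing over a star -/

section Star

variable {B Y : Type*} [TopologicalSpace Y] [NormedAddCommGroup B] [NormedSpace ℂ B]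
  [NormedSpace ℝ B] [IsScalarTower ℝ ℂ B]

/-- A section over a generic fibre extends along every segment of the base that contains no point
whose whole fibre lies in the zero set of `F`. -/
theorem exists_extend_section_along_segment [Nonempty Y] {F : ℂ × B → ℂ} (hF : IsLinePoly F)
    (hFc : Continuous F) {π : Y → {x | F x ≠ 0}} (hπ : IsCoveringMap π) {D : B → ℂ}
    (hD : IsLinePoly D) (hDc : Continuous D) (hE : ∀ y, D y ≠ 0 → HasExtensionsNear F π y)
    {y₀ y₁ : B} (hDy : D y₀ ≠ 0)
    (hseg : ∀ t ∈ Icc (0 : ℝ) 1, ∃ c, F (c, AffineMap.lineMap y₀ y₁ t) ≠ 0)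
    {s₀ : ℂ × B → Y} (hs₀ : IsSectionOn π s₀ (tube F {y₀})) :
    ∃ W : Set B, IsOpen W ∧ Convex ℝ W ∧ y₀ ∈ W ∧ y₁ ∈ W ∧
      ∃ t, IsSectionOn π t (tube F W) ∧ EqOn t s₀ (tube F {y₀}) := by
  let l : ℝ → B := fun t => AffineMap.lineMap y₀ y₁ t
  have hl : Continuous l := AffineMap.lineMap_continuous
  -- By the Lebesgue number, each ball of radius δ centred on the segment has one height `c` whose
  -- slice avoids the zeros of `F`.
  obtain ⟨δ, hδ, hδc⟩ := lebesgue_number_lemma_of_metric (s := l '' Icc 0 1)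
    (c := fun c : ℂ => {y | F (c, y) ≠ 0}) (isCompact_Icc.image hl)
    (fun c => isOpen_ne_fun (by fun_prop) continuous_const) (by
      rintro _ ⟨t, ht, rfl⟩
      exact mem_iUnion.2 (hseg t ht))
  -- Steps shorter than δ/2 ensure that the δ/2-thickening of the next piece lies in the δ-ball
  -- about the end of the current one.
  obtain ⟨n, hn⟩ := exists_nat_gt (dist y₀ y₁ / (δ / 2))
  have hn0 : (0 : ℝ) < n := lt_of_le_of_lt (by positivity) hn
  let W : ℝ → Set B := fun a => Metric.thickening (δ / 2) (l '' Icc 0 a)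
  have hWo : ∀ a, IsOpen (W a) := fun a => Metric.isOpen_thickening
  have hWc : ∀ a, Convex ℝ (W a) := fun a =>
    ((convex_Icc 0 a).affine_image (AffineMap.lineMap y₀ y₁)).thickening _
  have hlW : ∀ {t a : ℝ}, t ∈ Icc 0 a → l t ∈ W a := fun ht =>
    Metric.self_subset_thickening (half_pos hδ) _ (mem_image_of_mem l ht)
  have hl0 : l 0 = y₀ := AffineMap.lineMap_apply_zero _ _
  have hl1 : l 1 = y₁ := AffineMap.lineMap_apply_one _ _
  have hstep : ∀ k : ℕ, k ≤ n → ∃ t, IsSectionOn π t (tube F (W (k / n))) ∧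
      EqOn t s₀ (tube F {y₀}) := by
    intro k
    induction k with
    | zero =>
      intro _
      obtain ⟨c, hc⟩ := hδc (l 0) (mem_image_of_mem l (by simp))
      rw [hl0] at hc
      obtain ⟨t, ht, hts⟩ := exists_extend_section_of_slice hF hFc hπ hD hDc hE Metric.isOpen_ball
        (convex_ball y₀ δ) hc (Metric.mem_ball_self hδ) hDy hs₀
      refine ⟨t, ht.mono (tube_mono ?_), hts⟩
      simp only [W, Nat.cast_zero, zero_div, Icc_self, image_singleton,
        Metric.thickening_singleton, hl0]
      exact Metric.ball_subset_ball (by linarith)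
    | succ k ih =>
      intro hk
      obtain ⟨t, ht, hts⟩ := ih (by omega)
      set a : ℝ := k / n with ha
      have ha0 : 0 ≤ a := by positivity
      have ha1 : a ≤ 1 := by
        rw [ha, div_le_one hn0]
        exact_mod_cast (by omega : k ≤ n)
      have haW : l a ∈ W a := hlW ⟨ha0, le_rfl⟩
      obtain ⟨c, hc⟩ := hδc (l a) (mem_image_of_mem l ⟨ha0, ha1⟩)
      have hb : l a ∈ Metric.ball (l a) δ := Metric.mem_ball_self hδ
      -- The point `l a` may be a zero of `D`; the extension restarts from a nearby generic fibre.
      obtain ⟨y, ⟨hyW, hyb⟩, hDy'⟩ := hD.exists_ne_zero hDy ((hWo a).inter Metric.isOpen_ball)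
        ⟨l a, haW, hb⟩
      obtain ⟨u, hu, hut⟩ := exists_extend_section_of_slice hF hFc hπ hD hDc hE Metric.isOpen_ball
        (convex_ball (l a) δ) hc hyb hDy' (ht.mono (tube_mono (singleton_subset_iff.2 hyW)))
      have hcy : F (c, y) ≠ 0 := hc hyb
      obtain ⟨v, hv, hvt, -⟩ := exists_glue_two_sections (isOpen_tube hFc (hWo a))
        (isOpen_tube hFc Metric.isOpen_ball) ht hu (by
          rintro x ⟨hx, hx'⟩
          exact (ht.mono (tube_mono inter_subset_left)).eqOn hπ
            (hu.mono (tube_mono inter_subset_right))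
            (isPreconnected_tube hF ((hWo a).inter Metric.isOpen_ball)
              ((hWc a).inter (convex_ball _ _)))
            (⟨⟨hyW, hyb⟩, hcy⟩ : (c, y) ∈ tube F (W a ∩ Metric.ball (l a) δ))
            (hut ⟨rfl, hcy⟩).symm ⟨⟨hx.1, hx'.1⟩, hx.2⟩)
      refine ⟨v, hv.mono ?_, fun x hx => ?_⟩
      · rintro x ⟨hxW, hx⟩
        obtain ⟨_, ⟨p, hp, rfl⟩, hxp⟩ := Metric.mem_thickening_iff.1 hxW
        rcases le_or_gt p a with hpa | hpa
        · exact Or.inl ⟨Metric.mem_thickening_iff.2 ⟨_, ⟨p, ⟨hp.1, hpa⟩, rfl⟩, hxp⟩, hx⟩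
        · refine Or.inr ⟨?_, hx⟩
          have h1 : dist (l p) (l a) ≤ δ / 2 := by
            rw [show dist (l p) (l a) = dist p a * dist y₀ y₁ from dist_lineMap_lineMap ..,
              Real.dist_eq, abs_of_pos (sub_pos.2 hpa)]
            have h2 : p - a ≤ 1 / n := by
              have := hp.2
              rw [Nat.cast_succ, add_div] at this
              linarith
            have h3 : dist y₀ y₁ < n * (δ / 2) := (div_lt_iff₀ (half_pos hδ)).1 hn
            calc (p - a) * dist y₀ y₁ ≤ 1 / n * (n * (δ / 2)) :=
                  mul_le_mul h2 h3.le dist_nonneg (by positivity)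
              _ = δ / 2 := by field_simp
          calc dist x.2 (l a) ≤ dist x.2 (l p) + dist (l p) (l a) := dist_triangle _ _ _
            _ < δ / 2 + δ / 2 := add_lt_add_of_lt_of_le hxp h1
            _ = δ := add_halves δ
      · have hx' : x ∈ tube F (W a) := ⟨by
          rw [mem_preimage, show x.2 = y₀ from hx.1, ← hl0]
          exact hlW ⟨le_rfl, ha0⟩, hx.2⟩
        rw [hvt hx', hts hx]
  obtain ⟨t, ht, hts⟩ := hstep n le_rfl
  rw [div_self hn0.ne'] at ht
  exact ⟨W 1, hWo 1, hWc 1, hl0 ▸ hlW (by simp), hl1 ▸ hlW (by simp), t, ht, hts⟩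

/-- If the bad fibres are avoided by the segments joining `y₀` to the points outside the zero set of
`Q`, then a section over the fibre of `y₀` extends to a global section. -/
theorem exists_extend_section_of_star [Nonempty Y] {F : ℂ × B → ℂ} (hF : IsLinePoly F)
    (hFc : Continuous F) {π : Y → {x | F x ≠ 0}} (hπ : IsCoveringMap π) {D : B → ℂ}
    (hD : IsLinePoly D) (hDc : Continuous D) (hE : ∀ y, D y ≠ 0 → HasExtensionsNear F π y)
    {y₀ : B} (hDy : D y₀ ≠ 0) {c₀ : ℂ} (hc₀ : F (c₀, y₀) ≠ 0) {Q : B → ℂ} (hQ : IsLinePoly Q)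
    {b : B} (hb : Q b ≠ 0)
    (hseg : ∀ y, Q y ≠ 0 → ∀ t ∈ Icc (0 : ℝ) 1, ∃ c, F (c, AffineMap.lineMap y₀ y t) ≠ 0)
    {s₀ : ℂ × B → Y} (hs₀ : IsSectionOn π s₀ (tube F {y₀})) :
    ∃ t, IsSectionOn π t {x | F x ≠ 0} ∧ EqOn t s₀ (tube F {y₀}) := by
  have hO : IsOpen {x | F x ≠ 0} := isOpen_ne_fun hFc continuous_const
  choose W hWo hWc h0W hyW t ht hts using fun y : {y | Q y ≠ 0} =>
    exists_extend_section_along_segment hF hFc hπ hD hDc hE hDy (hseg y y.2) hs₀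
  have hp : (c₀, y₀) ∈ tube F {y₀} := ⟨rfl, hc₀⟩
  obtain ⟨u, hu, hut⟩ := exists_glue_sections (fun y => tube F (W y))
    (fun y => isOpen_tube hFc (hWo y)) t ht (by
      rintro y y' x ⟨hx, hx'⟩
      exact ((ht y).mono (tube_mono inter_subset_left)).eqOn hπ
        ((ht y').mono (tube_mono inter_subset_right))
        (isPreconnected_tube hF ((hWo y).inter (hWo y')) ((hWc y).inter (hWc y')))
        (⟨⟨h0W y, h0W y'⟩, hc₀⟩ : (c₀, y₀) ∈ tube F (W y ∩ W y')) ((hts y hp).trans (hts y' hp).symm)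
        ⟨⟨hx.1, hx'.1⟩, hx.2⟩)
  have hQ' := hQ.comp_linear (LinearMap.snd ℂ ℂ B)
  obtain ⟨v, hv, hvu⟩ := exists_extend_section hO hπ hQ' (b := (0, b)) hb hO subset_rfl
    (s := u) (hu.mono fun x hx => mem_iUnion.2 ⟨⟨x.2, hx.2⟩, hyW ⟨x.2, hx.2⟩, hx.1⟩)
  refine ⟨v, hv, ?_⟩
  -- `v` is known to equal `u` only where `Q` is nonzero, which may exclude y₀. The comparison is
  -- made at a nearby point and carried back through the connected tube over `W ⟨b, hb⟩`.
  obtain ⟨x, hx, hQx⟩ := hQ'.exists_ne_zero (b := (0, b)) hb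
    (isOpen_tube hFc (hWo ⟨b, hb⟩)) ⟨(c₀, y₀), h0W _, hc₀⟩
  have hvt : EqOn v (t ⟨b, hb⟩) (tube F (W ⟨b, hb⟩)) :=
    (hv.mono inter_subset_right).eqOn hπ (ht ⟨b, hb⟩)
      (isPreconnected_tube hF (hWo ⟨b, hb⟩) (hWc ⟨b, hb⟩)) hx
      ((hvu ⟨hx.2, hQx⟩).trans (hut ⟨b, hb⟩ hx))
  intro z hz
  rw [hvt (tube_mono (singleton_subset_iff.2 (h0W ⟨b, hb⟩)) hz), hts ⟨b, hb⟩ hz]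

end Star

/-! ### Local triviality of the family of punctured lines near simple zeros -/

section LocalTriviality

open unitInterval

/-- Solving z + g(z, x) = w means finding the fixed point of the contraction z ↦ w − g(z, x). The
factor 1/2 also bounds the variation of the fixed point, so the inverse is continuous. -/
theorem exists_homeomorph_add_of_lipschitz {X : Type*} [TopologicalSpace X] (g : ℂ × X → ℂ)
    (hg : Continuous g) (hl : ∀ x z w, dist (g (z, x)) (g (w, x)) ≤ 1 / 2 * dist z w) :
    ∃ h : ℂ × X ≃ₜ ℂ × X, ∀ z x, h (z, x) = (z + g (z, x), x) := by
  have hc : ∀ (w : ℂ) (x : X), ContractingWith (1 / 2) fun z : ℂ => w - g (z, x) := by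
    refine fun w x => ⟨by rw [← NNReal.coe_lt_coe]; norm_num, LipschitzWith.of_dist_le_mul ?_⟩
    intro z z'
    rw [dist_sub_left]
    simpa using hl x z z'
  let k : ℂ × X → ℂ := fun q => ContractingWith.fixedPoint _ (hc q.1 q.2)
  have hk : ∀ w x, w - g (k (w, x), x) = k (w, x) := fun w x => (hc w x).fixedPoint_isFixedPt
  have hku : ∀ {w x z}, w - g (z, x) = z → z = k (w, x) := fun {w x z} h =>
    (hc w x).fixedPoint_unique h
  have hkc : Continuous k := by
    refine continuous_iff_continuousAt.2 fun ⟨w₀, x₀⟩ => ?_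
    rw [ContinuousAt, tendsto_iff_dist_tendsto_zero]
    have h0 : Filter.Tendsto (fun q : ℂ × X => 2 * (dist q.1 w₀ +
        dist (g (k (w₀, x₀), q.2)) (g (k (w₀, x₀), x₀)))) (𝓝 (w₀, x₀)) (𝓝 0) := by
      have : Continuous fun q : ℂ × X => 2 * (dist q.1 w₀ +
        dist (g (k (w₀, x₀), q.2)) (g (k (w₀, x₀), x₀))) := by fun_prop
      simpa using this.tendsto (w₀, x₀)
    refine squeeze_zero (fun _ => dist_nonneg) ?_ h0
    rintro ⟨w, x⟩
    have h1 : dist (k (w, x)) (k (w₀, x₀)) ≤ dist w w₀ +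
        dist (g (k (w, x), x)) (g (k (w₀, x₀), x₀)) := by
      conv_lhs => rw [← hk w x, ← hk w₀ x₀]
      exact dist_sub_sub_le _ _ _ _
    have h2 := dist_triangle (g (k (w, x), x)) (g (k (w₀, x₀), x)) (g (k (w₀, x₀), x₀))
    have h3 := hl x (k (w, x)) (k (w₀, x₀))
    change dist (k (w, x)) (k (w₀, x₀)) ≤ 2 * (dist w w₀ +
      dist (g (k (w₀, x₀), x)) (g (k (w₀, x₀), x₀)))
    linarith
  refine ⟨⟨⟨fun q => (q.1 + g q, q.2), fun q => (k q, q.2), ?_, ?_⟩, by fun_prop, by fun_prop⟩,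
    fun z x => rfl⟩
  · rintro ⟨z, x⟩
    exact Prod.ext (hku (by simp)).symm rfl
  · rintro ⟨w, x⟩
    exact Prod.ext (sub_eq_iff_eq_add.1 (hk w x)).symm rfl

/-- Implicit function theorem. Continuity is recorded at all nearby points because the root must
vary continuously over a whole ball. -/
theorem exists_root_function {B : Type*} [NormedAddCommGroup B] [NormedSpace ℂ B] [CompleteSpace B]
    {F : ℂ × B → ℂ} (hF : ContDiff ℂ 1 F) {a : ℂ}
    {y₀ : B} (h0 : F (a, y₀) = 0) (hd : deriv (fun z => F (z, y₀)) a ≠ 0) :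
    ∃ ψ : B → ℂ, ψ y₀ = a ∧ ∀ᶠ y in 𝓝 y₀, ContinuousAt ψ y ∧ F (ψ y, y) = 0 := by
  let f : B × ℂ → ℂ := fun q => F (q.2, q.1)
  have hf : ContDiff ℂ 1 f := hF.comp (contDiff_snd.prodMk contDiff_fst)
  have hfa : ContDiffAt ℂ 1 f (y₀, a) := hf.contDiffAt
  have hinv : (fderiv ℂ f (y₀, a) ∘L .inr ℂ B ℂ).IsInvertible := by
    have h1 : HasFDerivAt (fun z : ℂ => F (z, y₀)) (fderiv ℂ f (y₀, a) ∘L .inr ℂ B ℂ) a :=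
      ((hf.differentiable one_ne_zero) (y₀, a)).hasFDerivAt.comp a (hasFDerivAt_prodMk_right y₀ a)
    have h2 : (fderiv ℂ f (y₀, a) ∘L .inr ℂ B ℂ) 1 ≠ 0 := by
      rwa [h1.hasDerivAt.deriv] at hd
    refine ⟨ContinuousLinearEquiv.unitsEquivAut ℂ (Units.mk0 _ h2), ?_⟩
    ext
    simp
  have h1 : (1 : WithTop ℕ∞) ≠ 0 := one_ne_zero
  refine ⟨hfa.implicitFunction h1 hinv, hfa.implicitFunction_apply_self h1 hinv, ?_⟩
  filter_upwards [hfa.eventually_apply_implicitFunction h1 hinv,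
    (hfa.contDiffAt_implicitFunction h1 hinv).eventually (by simp)] with y hy hy'
  exact ⟨hy'.continuousAt, hy.trans h0⟩

variable {B Y : Type*} [TopologicalSpace Y] [NormedAddCommGroup B] [NormedSpace ℝ B]

/-- Local triviality over a ball gives extensions of sections over nearby fibres. -/
theorem hasExtensionsNear_of_homeomorph {F : ℂ × B → ℂ} {π : Y → {x | F x ≠ 0}}
    (hπ : IsCoveringMap π) {y₀ : B} {ε : ℝ} (hε : 0 < ε) (S : Set ℂ)
    (h : ℂ × Metric.ball y₀ ε ≃ₜ ℂ × Metric.ball y₀ ε) (h2 : ∀ q, (h q).2 = q.2)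
    (hS : ∀ z y, F ((h (z, y)).1, y) = 0 ↔ z ∈ S) : HasExtensionsNear F π y₀ := by
  refine ⟨ε, hε, fun y' hy' s hs => ?_⟩
  let Ψ : (Sᶜ : Set ℂ) × Metric.ball y₀ ε → {x | F x ≠ 0} := fun q =>
    ⟨((h (q.1, q.2)).1, q.2), fun h0 => q.1.2 ((hS _ _).1 h0)⟩
  have hΨ : Continuous Ψ := by fun_prop
  let φ : I × Metric.ball y₀ ε → Metric.ball y₀ ε := fun q =>
    ⟨AffineMap.lineMap y' (q.2 : B) (q.1 : ℝ),
      (convex_ball y₀ ε).lineMap_mem hy' q.2.2 ⟨q.1.2.1, q.1.2.2⟩⟩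
  have hφ : Continuous φ := by
    refine Continuous.subtype_mk ?_ _
    simp only [AffineMap.lineMap_apply_module]
    fun_prop
  have hφ0 : ∀ n, φ (0, n) = ⟨y', hy'⟩ := fun n => Subtype.ext (by simp [φ])
  have hφ1 : ∀ n, φ (1, n) = n := fun n => Subtype.ext (by simp [φ])
  have hφy : ∀ t, φ (t, ⟨y', hy'⟩) = ⟨y', hy'⟩ := fun t => Subtype.ext (by simp [φ])
  have hΨt : ∀ z, (Ψ (z, ⟨y', hy'⟩) : ℂ × B) ∈ tube F {y'} := fun z => ⟨rfl, (Ψ _).2⟩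
  let f : C((Sᶜ : Set ℂ) × Metric.ball y₀ ε, Y) := ⟨fun q => s (Ψ (q.1, ⟨y', hy'⟩)),
    hs.1.comp_continuous (by fun_prop) fun q => hΨt q.1⟩
  -- Contracting the ball to `y'` gives a homotopy from the fibre over `y'` to the whole tube. Its
  -- lift starting at `s` ends at the extension, and is constant over `y'` itself.
  let H : C(I × ((Sᶜ : Set ℂ) × Metric.ball y₀ ε), {x | F x ≠ 0}) :=
    ⟨fun q => Ψ (q.2.1, φ (q.1, q.2.2)), by fun_prop⟩
  have H0 : ∀ a, H (0, a) = π (f a) := by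
    rintro ⟨z, n⟩
    change Ψ (z, φ (0, n)) = _
    rw [hφ0]
    exact Subtype.ext (hs.2 _ (hΨt z)).symm
  let L := hπ.liftHomotopy H f H0
  have hL : ∀ t z n, π (L (t, (z, n))) = Ψ (z, φ (t, n)) := fun t z n =>
    congrFun (hπ.liftHomotopy_lifts H f H0) (t, (z, n))
  have hLy : ∀ z, L (1, (z, ⟨y', hy'⟩)) = s (Ψ (z, ⟨y', hy'⟩)) := by
    intro z
    rw [← show L (0, (z, ⟨y', hy'⟩)) = s (Ψ (z, ⟨y', hy'⟩)) from hπ.liftHomotopy_zero H f H0 _]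
    exact hπ.const_of_comp (g := fun t => L (t, (z, ⟨y', hy'⟩))) (by fun_prop)
      (fun t t' => by rw [hL, hL, hφy, hφy]) 1 0
  have hsymm : ∀ z n, h ((h.symm (z, n)).1, n) = (z, n) := by
    intro z n
    have h3 : (h.symm (z, n)).2 = n := by rw [← h2, h.apply_symm_apply]
    have h4 : ((h.symm (z, n)).1, n) = h.symm (z, n) := Prod.ext rfl h3.symm
    rw [h4, h.apply_symm_apply]
  have hΘ : ∀ x : tube F (Metric.ball y₀ ε), (h.symm (x.1.1, ⟨x.1.2, x.2.1⟩)).1 ∈ Sᶜ := by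
    intro x hx
    have h4 := (hS _ ⟨x.1.2, x.2.1⟩).2 hx
    rw [hsymm] at h4
    exact x.2.2 h4
  let Θ : tube F (Metric.ball y₀ ε) → (Sᶜ : Set ℂ) × Metric.ball y₀ ε := fun x =>
    (⟨(h.symm (x.1.1, ⟨x.1.2, x.2.1⟩)).1, hΘ x⟩, ⟨x.1.2, x.2.1⟩)
  have hΘc : Continuous Θ := by fun_prop
  have hΨΘ : ∀ x, (Ψ (Θ x) : ℂ × B) = x := by
    intro x
    have h5 := congrArg Prod.fst (hsymm x.1.1 ⟨x.1.2, x.2.1⟩)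
    exact Prod.ext h5 rfl
  classical
  let t : ℂ × B → Y := fun x => if hx : x ∈ tube F (Metric.ball y₀ ε) then L (1, Θ ⟨x, hx⟩) else s x
  have ht : ∀ x (hx : x ∈ tube F (Metric.ball y₀ ε)), t x = L (1, Θ ⟨x, hx⟩) :=
    fun x hx => dif_pos hx
  refine ⟨t, ⟨?_, fun x hx => ?_⟩, fun x hx => ?_⟩
  · rw [continuousOn_iff_continuous_domRestrict]
    have : Continuous fun x : tube F (Metric.ball y₀ ε) => L (1, Θ x) := by fun_prop
    exact this.congr fun x => (ht x x.2).symm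
  · rw [ht x hx, hL, hφ1]
    exact hΨΘ ⟨x, hx⟩
  · have hxy : x.2 = y' := hx.1
    subst hxy
    have hx' : x ∈ tube F (Metric.ball y₀ ε) := ⟨hy', hx.2⟩
    rw [ht x hx']
    have := hLy (Θ ⟨x, hx'⟩).1
    exact this.trans (congrArg s (hΨΘ ⟨x, hx'⟩))

/-- If `F (·, y₀)` has simple zeros, and `F (·, y)` has no more zeros for `y` near `y₀`, then
sections over the nearby fibres extend. -/
theorem hasExtensionsNear_of_simple_zeros [NormedSpace ℂ B] [CompleteSpace B]
    {F : ℂ × B → ℂ} (hF : ContDiff ℂ 1 F) {π : Y → {x | F x ≠ 0}} (hπ : IsCoveringMap π) {y₀ : B} (S : Finset ℂ)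
    (hS : ∀ a ∈ S, F (a, y₀) = 0 ∧ deriv (fun z => F (z, y₀)) a ≠ 0)
    (hcard : ∀ᶠ y in 𝓝 y₀, ∃ T : Finset ℂ, T.card ≤ S.card ∧ ∀ z, F (z, y) = 0 → z ∈ T) :
    HasExtensionsNear F π y₀ := by
  classical
  choose! ψ hψ0 hψ using fun a ha => exists_root_function hF (hS a ha).1 (hS a ha).2
  obtain ⟨ρ, hρS, hρ⟩ : ∃ ρ : ℝ, (∀ a ∈ S, ∀ b ∈ S, a ≠ b → ρ ≤ dist a b) ∧ 0 < ρ := by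
    have : ∀ᶠ ρ : ℝ in 𝓝[>] 0, ∀ a ∈ S, ∀ b ∈ S, a ≠ b → ρ ≤ dist a b := by
      simp only [Filter.eventually_all_finset, Filter.eventually_imp_distrib_left]
      intro a _ b _ hab
      filter_upwards [Ioo_mem_nhdsGT (dist_pos.2 hab)] with ρ hρ using hρ.2.le
    exact (this.and self_mem_nhdsWithin).exists
  -- Each of the `S.card` summands of `g` below has Lipschitz constant at most η/ρ; this η keeps the
  -- total at most 1/2, even for empty `S`.
  set η : ℝ := ρ / (2 * (S.card + 1)) with hη
  have hη0 : 0 < η := by positivity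
  have hev : ∀ᶠ y in 𝓝 y₀, (∃ T : Finset ℂ, T.card ≤ S.card ∧ ∀ z, F (z, y) = 0 → z ∈ T) ∧
      ∀ a ∈ S, (ContinuousAt (ψ a) y ∧ F (ψ a y, y) = 0) ∧ dist (ψ a y) a < η := by
    refine hcard.and ((Filter.eventually_all_finset S).2 fun a ha => (hψ a ha).and ?_)
    have h1 : Filter.Tendsto (ψ a) (𝓝 y₀) (𝓝 a) := by
      simpa [hψ0 a ha] using (hψ a ha).self_of_nhds.1.tendsto
    exact h1.eventually (Metric.ball_mem_nhds a hη0)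
  obtain ⟨ε, hε, hball⟩ := Metric.eventually_nhds_iff_ball.1 hev
  -- A cutoff equal to 1 at `a` and 0 at the other points of `S`, so that adding `g` moves each `a`
  -- exactly to the root `ψ a y`.
  let χ : ℂ → ℂ → ℝ := fun a z => max 0 (1 - dist z a / ρ)
  have hχ : ∀ a z w, |χ a z - χ a w| ≤ dist z w / ρ := by
    intro a z w
    have h1 : |dist w a - dist z a| ≤ dist z w := by
      rw [dist_comm z w]
      exact abs_dist_sub_le w z a
    calc |χ a z - χ a w| ≤ |(1 - dist z a / ρ) - (1 - dist w a / ρ)| := by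
          simpa using abs_max_sub_max_le_max 0 (1 - dist z a / ρ) 0 (1 - dist w a / ρ)
      _ = |dist w a - dist z a| / ρ := by
          rw [show (1 - dist z a / ρ) - (1 - dist w a / ρ) = (dist w a - dist z a) / ρ by ring,
            abs_div, abs_of_pos hρ]
      _ ≤ dist z w / ρ := by gcongr
  let g : ℂ × Metric.ball y₀ ε → ℂ := fun q => ∑ a ∈ S, (χ a q.1 : ℂ) * (ψ a q.2 - a)
  have hψc : ∀ a ∈ S, Continuous fun y : Metric.ball y₀ ε => ψ a y := fun a ha =>
    continuous_iff_continuousAt.2 fun y =>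
      ((hball y y.2).2 a ha).1.1.comp continuous_subtype_val.continuousAt
  have hg : Continuous g := by
    refine continuous_finsetSum _ fun a ha => ?_
    have h1 := (hψc a ha).comp (continuous_snd (X := ℂ))
    have h2 : Continuous (χ a) := by fun_prop
    exact (Complex.continuous_ofReal.comp (h2.comp continuous_fst)).mul (h1.sub continuous_const)
  have hgl : ∀ x z w, dist (g (z, x)) (g (w, x)) ≤ 1 / 2 * dist z w := by
    intro x z w
    rw [dist_eq_norm, ← Finset.sum_sub_distrib]
    calc ‖∑ a ∈ S, ((χ a z : ℂ) * (ψ a x - a) - (χ a w : ℂ) * (ψ a x - a))‖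
        ≤ ∑ a ∈ S, dist z w / ρ * η := by
          refine norm_sum_le_of_le _ fun a ha => ?_
          rw [← sub_mul, ← Complex.ofReal_sub, norm_mul, Complex.norm_real, Real.norm_eq_abs,
            ← dist_eq_norm]
          exact mul_le_mul (hχ a z w) ((hball x x.2).2 a ha).2.le dist_nonneg (by positivity)
      _ = (S.card / (S.card + 1)) * (1 / 2 * dist z w) := by
          rw [Finset.sum_const, nsmul_eq_mul, hη]
          field_simp
      _ ≤ 1 * (1 / 2 * dist z w) := by
          gcongr
          rw [div_le_one (by positivity)]
          linarith
      _ = 1 / 2 * dist z w := one_mul _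
  obtain ⟨h, hh⟩ := exists_homeomorph_add_of_lipschitz g hg hgl
  have hgS : ∀ a ∈ S, ∀ y, a + g (a, y) = ψ a y := by
    intro a ha y
    have : g (a, y) = (χ a a : ℂ) * (ψ a y - a) := by
      refine Finset.sum_eq_single a (fun b hb hba => ?_) (fun h => absurd ha h)
      have : χ b a = 0 := max_eq_left <| by
        rw [sub_nonpos, one_le_div hρ]
        exact hρS a ha b hb hba.symm
      simp [this]
    rw [this]
    simp [χ]
  have hinj : ∀ y, Function.Injective fun z => z + g (z, y) := by
    intro y z w hzw
    have : h (z, y) = h (w, y) := by rw [hh, hh]; exact Prod.ext hzw rfl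
    exact congrArg Prod.fst (h.injective this)
  refine hasExtensionsNear_of_homeomorph hπ hε (S : Set ℂ) h
    (fun q => by rw [← Prod.mk.eta (p := q), hh]) fun z y => ?_
  rw [hh]
  constructor
  · intro hz
    obtain ⟨⟨T, hT, hTz⟩, hy⟩ := hball y y.2
    -- The displaced points are `S.card` distinct zeros inside a set of at most that size, so they
    -- are all the zeros.
    have hsub : S.image (fun z => z + g (z, y)) ⊆ T := by
      refine Finset.image_subset_iff.2 fun a ha => hTz _ ?_
      rw [hgS a ha]
      exact (hy a ha).1.2
    have hST := Finset.eq_of_subset_of_card_le hsub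
      (by rwa [Finset.card_image_of_injective _ (hinj y)])
    obtain ⟨a, ha, haz⟩ := Finset.mem_image.1 (hST ▸ hTz _ hz)
    exact hinj y haz ▸ ha
  · intro hz
    change F (z + g (z, y), y) = 0
    rw [hgS z hz]
    exact ((hball y y.2).2 z hz).1.2

end LocalTriviality

/-! ### Coprime polynomials and generic lines through a point -/

section Elimination

variable {σ : Type*}

theorem exists_prime_dvd_of_natDegree_pos {R : Type*} [CommRing R] [IsDomain R]
    [UniqueFactorizationMonoid R] (f : Polynomial R) (hf : 0 < f.natDegree) :
    ∃ h : Polynomial R, Prime h ∧ 0 < h.natDegree ∧ h ∣ f := by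
  induction f using UniqueFactorizationMonoid.induction_on_prime with
  | h₁ => simp at hf
  | h₂ x hx => exact absurd (Polynomial.natDegree_eq_zero_of_isUnit hx) hf.ne'
  | h₃ a p ha hp ih =>
    by_cases h : 0 < p.natDegree
    · exact ⟨p, hp, h, dvd_mul_right p a⟩
    · rw [Polynomial.natDegree_mul hp.ne_zero ha] at hf
      obtain ⟨q, hq, hq0, hqa⟩ := ih (by omega)
      exact ⟨q, hq, hq0, hqa.mul_left p⟩

/-- If no polynomial of positive degree divides every member of an ideal of `R[X]`, then this ideal
contains a nonzero constant. -/
theorem exists_C_mem_of_forall_dvd {R : Type*} [CommRing R] [IsDomain R]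
    [UniqueFactorizationMonoid R] (I : Ideal (Polynomial R))
    (hI : ∀ h : Polynomial R, (∀ f ∈ I, h ∣ f) → h.natDegree = 0) :
    ∃ Q : R, Q ≠ 0 ∧ Polynomial.C Q ∈ I := by
  let K := FractionRing R
  by_contra! hne
  let _ : Algebra (Polynomial R) (Polynomial K) := Polynomial.algebra R K
  have hloc : IsLocalization (Submonoid.map Polynomial.C (nonZeroDivisors R)) (Polynomial K) :=
    Polynomial.isLocalization (nonZeroDivisors R) K
  -- Without a nonzero constant, `I` stays proper in the principal ideal ring K[X], so a nonconstant
  -- `g` divides all of it there. Clearing denominators brings a prime factor of `g` back to R[X].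
  have htop : I.map (algebraMap (Polynomial R) (Polynomial K)) ≠ ⊤ := by
    rw [IsLocalization.map_algebraMap_ne_top_iff_disjoint
      (Submonoid.map Polynomial.C (nonZeroDivisors R))]
    rw [disjoint_left]
    rintro _ ⟨Q, hQ, rfl⟩ hQI
    exact hne Q (nonZeroDivisors.ne_zero hQ) hQI
  obtain ⟨M, hM, hIM⟩ := Ideal.exists_le_maximal _ htop
  obtain ⟨g, rfl⟩ := (IsPrincipalIdealRing.principal M).principal
  have hg0 : g ≠ 0 := by
    rintro rfl
    rw [Submodule.span_zero_singleton] at hM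
    exact Polynomial.not_isField K (Ring.isField_iff_maximal_bot.2 hM)
  have hgdeg : 0 < g.natDegree := by
    by_contra h
    rw [Polynomial.eq_C_of_natDegree_eq_zero (by omega : g.natDegree = 0)] at hM hg0
    refine hM.ne_top (Ideal.span_singleton_eq_top.2 (Polynomial.isUnit_C.2 (IsUnit.mk0 _ ?_)))
    exact fun h0 => hg0 (by rw [h0, Polynomial.C_0])
  have hinj : Function.Injective (algebraMap R K) := IsFractionRing.injective R K
  obtain ⟨b, hb, hgb⟩ := IsLocalization.integerNormalization_spec (nonZeroDivisors R) g
  set g' := IsLocalization.integerNormalization (nonZeroDivisors R) g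
  have hbK : algebraMap R K b ≠ 0 := fun h0 =>
    nonZeroDivisors.ne_zero hb (hinj (h0.trans (map_zero _).symm))
  rw [← algebraMap_smul K b g, Polynomial.smul_eq_C_mul] at hgb
  have hg'deg : 0 < g'.natDegree := by
    rwa [← Polynomial.natDegree_map_eq_of_injective hinj, hgb, Polynomial.natDegree_C_mul hbK]
  obtain ⟨h, hh, hh0, hhg⟩ := exists_prime_dvd_of_natDegree_pos g' hg'deg
  refine hh0.ne' (hI h fun f hf => ?_)
  have hgf : g'.map (algebraMap R K) ∣ f.map (algebraMap R K) := by
    rw [hgb, (Polynomial.isUnit_C.2 (IsUnit.mk0 _ hbK)).mul_left_dvd]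
    exact Ideal.mem_span_singleton.1 (hIM (Ideal.mem_map_of_mem _ hf))
  obtain ⟨q, hq⟩ := hgf
  obtain ⟨c, hc, hqc⟩ := IsLocalization.integerNormalization_spec (nonZeroDivisors R) q
  set q' := IsLocalization.integerNormalization (nonZeroDivisors R) q
  rw [← algebraMap_smul K c q, Polynomial.smul_eq_C_mul] at hqc
  have hc0 : c ≠ 0 := nonZeroDivisors.ne_zero hc
  have hcf : Polynomial.C c * f = g' * q' := by
    apply Polynomial.map_injective _ hinj
    rw [Polynomial.map_mul, Polynomial.map_mul, hqc, hq, Polynomial.map_C]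
    ring
  refine (hh.dvd_or_dvd (hcf ▸ hhg.mul_right q')).resolve_left fun hhc => ?_
  have := Polynomial.natDegree_le_of_dvd hhc (Polynomial.C_ne_zero.2 hc0)
  rw [Polynomial.natDegree_C] at this
  omega

open MvPolynomial in
/-- Let `a k` be coprime polynomials, not all zero at `y₀`. Then the lines through `y₀` in the
directions outside the zero set of some nonzero polynomial contain no common zero of the `a k`. -/
theorem exists_forall_line_ne_zero {ι : Type*} (a : ι → MvPolynomial σ ℂ)
    (ha : ∀ d, (∀ k, d ∣ a k) → IsUnit d) (y₀ : σ → ℂ) (k₀ : ι) (hk₀ : eval y₀ (a k₀) ≠ 0) :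
    ∃ Q : MvPolynomial σ ℂ, Q ≠ 0 ∧ ∀ v, eval v Q ≠ 0 → ∀ τ : ℂ, ∃ k, eval (y₀ + τ • v) (a k) ≠ 0 := by
  let φ : MvPolynomial σ ℂ →ₐ[ℂ] Polynomial (MvPolynomial σ ℂ) :=
    aeval fun j => Polynomial.C (C (y₀ j)) + Polynomial.X * Polynomial.C (X j)
  let ev (v : σ → ℂ) (τ : ℂ) : Polynomial (MvPolynomial σ ℂ) →+* ℂ :=
    Polynomial.eval₂RingHom (eval v) τ
  have hCC : ∀ c : ℂ, algebraMap ℂ (Polynomial (MvPolynomial σ ℂ)) c = Polynomial.C (C c) :=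
    fun _ => rfl
  have hφ : ∀ v τ b, ev v τ (φ b) = eval (y₀ + τ • v) b := by
    intro v τ b
    induction b using MvPolynomial.induction_on with
    | C c => simp [φ, ev, hCC]
    | add p q hp hq => simp only [map_add, hp, hq]
    | mul_X p j hp => rw [map_mul, map_mul, hp, map_mul]; simp [φ, ev, mul_comm τ]
  -- Here `φ b` is b(y₀ + τv) as a polynomial in τ over ℂ[v]. A nonzero `Q` in ℂ[v] lying in the
  -- ideal of the `φ (a k)` vanishes at every direction v whose line contains a common zero.
  obtain ⟨Q, hQ, hQI⟩ := exists_C_mem_of_forall_dvd (Ideal.span (range fun k => φ (a k))) (by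
    intro h hh
    have hdvd : ∀ k, h ∣ φ (a k) := fun k => hh _ (Ideal.subset_span ⟨k, rfl⟩)
    -- For `τ ≠ 0`, the value of `h` at `(v, τ)` does not depend on `v`.
    have hconst : ∀ τ : ℂ, τ ≠ 0 → ∀ v, ev v τ h = ev 0 τ h := by
      intro τ hτ
      -- The substitution v = (x − y₀)/τ undoes `φ`, so `θ h` is a common divisor of the `a k`,
      -- hence a constant.
      let θ : Polynomial (MvPolynomial σ ℂ) →+* MvPolynomial σ ℂ :=
        Polynomial.eval₂RingHom (aeval fun j => C τ⁻¹ * (X j - C (y₀ j)) :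
          MvPolynomial σ ℂ →ₐ[ℂ] MvPolynomial σ ℂ).toRingHom (C τ)
      have hθφ : ∀ b, θ (φ b) = b := by
        intro b
        induction b using MvPolynomial.induction_on with
        | C c => simp [φ, θ, hCC]
        | add p q hp hq => simp only [map_add, hp, hq]
        | mul_X p j hp =>
          rw [map_mul, map_mul, hp]
          have : C (σ := σ) τ * C τ⁻¹ = 1 := by rw [← C_mul, mul_inv_cancel₀ hτ, C_1]
          simp only [φ, θ, aeval_X, map_add, map_mul, Polynomial.coe_eval₂RingHom,
            Polynomial.eval₂_C, Polynomial.eval₂_X, AlgHom.toRingHom_eq_coe, RingHom.coe_coe,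
            algHom_C, MvPolynomial.algebraMap_eq]
          linear_combination (p * (X j - C (y₀ j))) * this
      have hu : IsUnit (θ h) := ha _ fun k => by
        rw [← hθφ (a k)]
        exact map_dvd θ (hdvd k)
      obtain ⟨c, -, hc⟩ := MvPolynomial.isUnit_iff_eq_C_of_isReduced.1 hu
      have hev : ∀ v q, eval (y₀ + τ • v) (θ q) = ev v τ q := by
        intro v q
        refine congrArg (fun f : Polynomial (MvPolynomial σ ℂ) →+* ℂ => f q)
          (?_ : (eval (y₀ + τ • v)).comp θ = ev v τ)
        refine Polynomial.ringHom_ext' (MvPolynomial.ringHom_ext (fun c => ?_) fun j => ?_) ?_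
        · simp [θ, ev]
        · simp [θ, ev, hτ]
        · simp [θ, ev]
      intro v
      rw [← hev, ← hev, hc, eval_C, eval_C]
    -- At v = 0, `h` divides the nonzero constant `a k₀` at y₀, so it is constant in τ there;
    -- independence of v carries this to every v.
    obtain ⟨c, hc⟩ : ∃ c, h.map (eval 0) = Polynomial.C c := by
      have h1 : (φ (a k₀)).map (eval 0) = Polynomial.C (eval y₀ (a k₀)) := by
        refine Polynomial.funext fun τ => ?_
        rw [Polynomial.eval_C, Polynomial.eval_map]
        exact (hφ 0 τ _).trans (by simp)
      have h2 := Polynomial.map_dvd (eval 0) (hdvd k₀)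
      rw [h1] at h2
      have h3 := isUnit_of_dvd_unit h2 (Polynomial.isUnit_C.2 (IsUnit.mk0 _ hk₀))
      exact ⟨_, Polynomial.eq_C_of_natDegree_eq_zero (Polynomial.natDegree_eq_zero_of_isUnit h3)⟩
    by_contra hdeg
    have hcoeff : h.coeff h.natDegree = 0 := by
      refine MvPolynomial.funext fun v => ?_
      have hv : h.map (eval v) = Polynomial.C c := by
        refine Polynomial.eq_of_infinite_eval_eq _ _ ((finite_singleton (0 : ℂ)).infinite_compl.mono ?_)
        intro τ hτ
        have h1 : ∀ w, (h.map (eval w)).eval τ = ev w τ h := fun w => Polynomial.eval_map _ _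
        rw [mem_ofPred_eq, ← hc, h1, h1, hconst τ hτ]
      have := congrArg (fun q => q.coeff h.natDegree) hv
      simpa [Polynomial.coeff_C, hdeg] using this
    rw [Polynomial.coeff_natDegree, Polynomial.leadingCoeff_eq_zero] at hcoeff
    simp [hcoeff] at hdeg)
  refine ⟨Q, hQ, fun v hv τ => ?_⟩
  by_contra! h0
  have hker : Ideal.span (range fun k => φ (a k)) ≤ RingHom.ker (ev v τ) := by
    rw [Ideal.span_le]
    rintro _ ⟨k, rfl⟩
    exact (hφ v τ (a k)).trans (h0 k)
  have := hker hQI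
  rw [RingHom.mem_ker] at this
  exact hv (by simpa [ev] using this)

end Elimination

/-! ### Fibres of the polynomial in X and the discriminant -/

section Evaluation

variable {σ : Type*}

/-- The function on `ℂ × ℂ^σ` defined by a polynomial in `X` with coefficients in `ℂ[Y]`. -/
noncomputable def evalXY (p : Polynomial (MvPolynomial σ ℂ)) (x : ℂ × (σ → ℂ)) : ℂ :=
  (p.map (MvPolynomial.eval x.2)).eval x.1

theorem evalXY_eq_sum (p : Polynomial (MvPolynomial σ ℂ)) :
    evalXY p = fun x => ∑ k ∈ Finset.range (p.natDegree + 1),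
      MvPolynomial.eval x.2 (p.coeff k) * x.1 ^ k := by
  funext x
  rw [evalXY, Polynomial.eval_map, Polynomial.eval₂_eq_sum_range]

variable [Fintype σ]

theorem isLinePoly_eval (q : MvPolynomial σ ℂ) :
    IsLinePoly fun y : σ → ℂ => MvPolynomial.eval y q := by
  induction q using MvPolynomial.induction_on with
  | C c => simpa using IsLinePoly.const c
  | add p q hp hq => simpa using hp.add hq
  | mul_X p j hp => simpa using hp.mul (IsLinePoly.linear (LinearMap.proj j))

theorem contDiff_eval (q : MvPolynomial σ ℂ) :
    ContDiff ℂ 1 fun y : σ → ℂ => MvPolynomial.eval y q := by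
  induction q using MvPolynomial.induction_on with
  | C c => simpa using contDiff_const
  | add p q hp hq => simpa using hp.add hq
  | mul_X p j hp =>
    simp only [map_mul, MvPolynomial.eval_X]
    exact hp.mul (by fun_prop)

theorem IsLinePoly.sum {V ι : Type*} [NormedAddCommGroup V] [NormedSpace ℂ V] (s : Finset ι)
    (f : ι → V → ℂ) (hf : ∀ i ∈ s, IsLinePoly (f i)) : IsLinePoly fun x => ∑ i ∈ s, f i x := by
  classical
  induction s using Finset.induction_on with
  | empty => simpa using IsLinePoly.const 0
  | insert a s ha ih =>
    simp only [Finset.sum_insert ha]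
    exact (hf a (Finset.mem_insert_self a s)).add
      (ih fun i hi => hf i (Finset.mem_insert_of_mem hi))

theorem isLinePoly_evalXY (p : Polynomial (MvPolynomial σ ℂ)) : IsLinePoly (evalXY p) := by
  rw [evalXY_eq_sum]
  refine IsLinePoly.sum _ _ fun k _ => ?_
  have h1 : IsLinePoly fun x : ℂ × (σ → ℂ) => MvPolynomial.eval x.2 (p.coeff k) :=
    (isLinePoly_eval (p.coeff k)).comp_linear (LinearMap.snd ℂ ℂ (σ → ℂ))
  have h2 : IsLinePoly fun x : ℂ × (σ → ℂ) => x.1 :=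
    IsLinePoly.linear (LinearMap.fst ℂ ℂ (σ → ℂ))
  exact h1.mul (h2.pow k)

theorem contDiff_evalXY (p : Polynomial (MvPolynomial σ ℂ)) : ContDiff ℂ 1 (evalXY p) := by
  rw [evalXY_eq_sum]
  refine ContDiff.sum fun k _ => ContDiff.mul ?_ (contDiff_fst.pow k)
  exact (contDiff_eval (p.coeff k)).comp contDiff_snd

omit [Fintype σ] in
/-- Where the resultant of `P'` and `P` does not vanish, `P` keeps its degree and has only simple
roots. -/
theorem natDegree_map_and_isCoprime (p : Polynomial (MvPolynomial σ ℂ))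
    (hcop : ∀ d, (∀ k, d ∣ p.coeff k) → IsUnit d) (y : σ → ℂ)
    (hy : MvPolynomial.eval y (Polynomial.resultant (Polynomial.derivative p) p) ≠ 0) :
    (p.map (MvPolynomial.eval y)).natDegree = p.natDegree ∧
      IsCoprime (Polynomial.derivative (p.map (MvPolynomial.eval y)))
        (p.map (MvPolynomial.eval y)) := by
  set q := p.map (MvPolynomial.eval y) with hq
  rcases Nat.eq_zero_or_pos p.natDegree with h0 | hpos
  · have hu : IsUnit (p.coeff 0) := hcop _ fun k => by
      rcases Nat.eq_zero_or_pos k with rfl | hk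
      · exact dvd_rfl
      · rw [Polynomial.coeff_eq_zero_of_natDegree_lt (n := k) (by omega)]
        exact dvd_zero _
    have hqu : IsUnit q := by
      rw [hq, Polynomial.eq_C_of_natDegree_eq_zero h0, Polynomial.map_C]
      exact Polynomial.isUnit_C.2 (hu.map _)
    exact ⟨by rw [h0, Polynomial.natDegree_eq_zero_of_isUnit hqu], ⟨0, ↑hqu.unit⁻¹, by simp⟩⟩
  have hdeg : (Polynomial.derivative p).natDegree = p.natDegree - 1 :=
    Polynomial.natDegree_derivative p
  rw [← Polynomial.resultant_map_map, ← Polynomial.derivative_map, ← hq, hdeg] at hy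
  have hqdeg : q.natDegree = p.natDegree := by
    by_contra hne
    have hlt : q.natDegree < p.natDegree :=
      lt_of_le_of_ne (Polynomial.natDegree_map_le) hne
    apply hy
    -- If the degree drops, both leading coefficients vanish and so does the resultant of formal
    -- degrees n − 1 and n. For n = 1 the derivative has formal degree 0 and is treated as a
    -- constant.
    rcases Nat.eq_or_lt_of_le (show 1 ≤ p.natDegree from hpos) with h1 | h1
    · rw [← h1, Nat.sub_self, Polynomial.resultant_zero_left_deg, Polynomial.coeff_derivative,
        Polynomial.coeff_eq_zero_of_natDegree_lt (by omega)]
      simp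
    · refine Polynomial.resultant_eq_zero_of_lt_lt _ _ _ _ ?_ hlt
      have := Polynomial.natDegree_derivative_le q
      omega
  refine ⟨hqdeg, ?_⟩
  have h1 : (Polynomial.derivative q).natDegree = p.natDegree - 1 := by
    rw [Polynomial.natDegree_derivative, hqdeg]
  rw [← h1, ← hqdeg] at hy
  by_contra hcop'
  refine hy (Polynomial.resultant_eq_zero_iff.2 ⟨Or.inr ?_, hcop'⟩)
  rintro h
  rw [h, Polynomial.natDegree_zero] at hqdeg
  omega

/-- A generic fibre has exactly `p.natDegree` distinct simple roots. Nearby fibres are generic with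
the same degree, so they have no more roots. -/
theorem hasExtensionsNear_evalXY (p : Polynomial (MvPolynomial σ ℂ))
    (hcop : ∀ d, (∀ k, d ∣ p.coeff k) → IsUnit d) {Y : Type*} [TopologicalSpace Y]
    {π : Y → {x | evalXY p x ≠ 0}} (hπ : IsCoveringMap π) (y : σ → ℂ)
    (hy : MvPolynomial.eval y (Polynomial.resultant (Polynomial.derivative p) p) ≠ 0) :
    HasExtensionsNear (evalXY p) π y := by
  obtain ⟨hdeg, hcopy⟩ := natDegree_map_and_isCoprime p hcop y hy
  refine hasExtensionsNear_of_simple_zeros (contDiff_evalXY p) hπ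
    (p.map (MvPolynomial.eval y)).roots.toFinset (fun a ha => ?_) ?_
  · have h0 : (p.map (MvPolynomial.eval y)).eval a = 0 :=
      (Polynomial.mem_roots'.1 (Multiset.mem_toFinset.1 ha)).2
    refine ⟨h0, ?_⟩
    change deriv (fun z => (p.map (MvPolynomial.eval y)).eval z) a ≠ 0
    rw [Polynomial.deriv]
    intro h1
    obtain ⟨u, v, huv⟩ := hcopy
    have := congrArg (Polynomial.eval a) huv
    rw [Polynomial.eval_add, Polynomial.eval_mul, Polynomial.eval_mul, h0, h1] at this
    simp at this
  · have hcard : (p.map (MvPolynomial.eval y)).roots.toFinset.card = p.natDegree := by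
      rw [Multiset.toFinset_card_of_nodup
        (Polynomial.nodup_roots (Polynomial.separable_def _ |>.2 hcopy.symm)), ← hdeg]
      exact (IsAlgClosed.splits _).natDegree_eq_card_roots.symm
    have hev : ∀ᶠ y' in 𝓝 y, MvPolynomial.eval y'
        (Polynomial.resultant (Polynomial.derivative p) p) ≠ 0 :=
      (contDiff_eval _).continuous.continuousAt.eventually_ne hy
    filter_upwards [hev] with y' hy'
    obtain ⟨hdeg', hcop'⟩ := natDegree_map_and_isCoprime p hcop y' hy'
    refine ⟨(p.map (MvPolynomial.eval y')).roots.toFinset, ?_, fun z hz => ?_⟩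
    · rw [hcard, ← hdeg']
      exact (Multiset.toFinset_card_le _).trans (Polynomial.card_roots' _)
    · have hne : p.map (MvPolynomial.eval y') ≠ 0 := by
        intro h0
        rw [h0, Polynomial.derivative_zero] at hcop'
        exact not_isCoprime_zero_zero hcop'
      rw [Multiset.mem_toFinset, Polynomial.mem_roots hne]
      exact hz

/-- Every section of a covering of the complement of the hypersurface over a generic fibre extends
to a global section. -/
theorem exists_extend_section_evalXY (p : Polynomial (MvPolynomial σ ℂ))
    (hcop : ∀ d, (∀ k, d ∣ p.coeff k) → IsUnit d) {Y : Type*} [TopologicalSpace Y] [Nonempty Y]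
    {π : Y → {x | evalXY p x ≠ 0}} (hπ : IsCoveringMap π) (y : σ → ℂ)
    (hy : MvPolynomial.eval y (Polynomial.resultant (Polynomial.derivative p) p) ≠ 0)
    {s : ℂ × (σ → ℂ) → Y} (hs : IsSectionOn π s (tube (evalXY p) {y})) :
    ∃ t, IsSectionOn π t {x | evalXY p x ≠ 0} ∧ EqOn t s (tube (evalXY p) {y}) := by
  have hex : ∀ y' k, MvPolynomial.eval y' (p.coeff k) ≠ 0 → ∃ c, evalXY p (c, y') ≠ 0 := by
    intro y' k hk
    by_contra! h0
    have : p.map (MvPolynomial.eval y') = 0 := Polynomial.funext fun c => by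
      rw [Polynomial.eval_zero]
      exact h0 c
    apply hk
    rw [← Polynomial.coeff_map, this, Polynomial.coeff_zero]
  obtain ⟨k₀, hk₀⟩ : ∃ k, MvPolynomial.eval y (p.coeff k) ≠ 0 := by
    by_contra! h0
    have h1 : p.map (MvPolynomial.eval y) = 0 := Polynomial.ext fun k => by
      rw [Polynomial.coeff_map, h0, Polynomial.coeff_zero]
    have h2 := (natDegree_map_and_isCoprime p hcop y hy).2
    rw [h1, Polynomial.derivative_zero] at h2
    exact not_isCoprime_zero_zero h2
  obtain ⟨c₀, hc₀⟩ := hex y k₀ hk₀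
  obtain ⟨Q, hQ0, hQ⟩ := exists_forall_line_ne_zero p.coeff hcop y k₀ hk₀
  obtain ⟨v, hv⟩ : ∃ v, MvPolynomial.eval v Q ≠ 0 := by
    by_contra! h0
    exact hQ0 (MvPolynomial.funext fun v => by rw [h0 v, map_zero])
  refine exists_extend_section_of_star (isLinePoly_evalXY p) (contDiff_evalXY p).continuous hπ
    (isLinePoly_eval (Polynomial.resultant (Polynomial.derivative p) p)) (contDiff_eval _).continuous
    (fun y' hy' => hasExtensionsNear_evalXY p hcop hπ y' hy') hy hc₀
    -- `Q` tests directions, so it is evaluated at y' − y.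
    ((isLinePoly_eval Q).comp_add_right (-y)) (b := v + y) (by simpa using hv) ?_ hs
  intro y' hy' t _
  obtain ⟨k, hk⟩ := hQ (y' + -y) hy' t
  refine hex _ k ?_
  convert hk using 3
  rw [AffineMap.lineMap_apply_module', add_comm, sub_eq_add_neg]
  congr 1

end Evaluation

/-! ### Transfer to ℂ^r and conclusion -/

section Transport

variable {r : ℕ} (i₀ : Fin r) (P : MvPolynomial (Fin r) ℂ)

theorem evalXY_polyInX (z : Fin r → ℂ) :
    evalXY (polyInX i₀ P) (z i₀, projY i₀ z) = MvPolynomial.eval z P := by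
  let ev : Polynomial (MvPolynomial (YIndex i₀) ℂ) →+* ℂ :=
    Polynomial.eval₂RingHom (MvPolynomial.eval (projY i₀ z)) (z i₀)
  have hev : ∀ q, evalXY q (z i₀, projY i₀ z) = ev q := fun q => Polynomial.eval_map _ _
  rw [hev]
  unfold polyInX
  induction P using MvPolynomial.induction_on with
  | C c =>
    have : algebraMap ℂ (Polynomial (MvPolynomial (YIndex i₀) ℂ)) c =
      Polynomial.C (MvPolynomial.C c) := rfl
    simp [ev, this]
  | add p q hp hq => simp only [map_add, hp, hq]
  | mul_X p j hp =>
    rw [map_mul, map_mul, hp, map_mul, MvPolynomial.aeval_X, MvPolynomial.eval_X]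
    congr 1
    split_ifs with h
    · simp [ev, h]
    · simp [ev, projY]

/-- A ball is contractible, so the two paths are already homotopic inside it. -/
theorem homotopicPathsIn_ball {V : Type*} [NormedAddCommGroup V] [NormedSpace ℝ V] {O : Set V}
    {x : V} {ε : ℝ} (h : Metric.ball x ε ⊆ O) :
    HomotopicPathsIn (Subtype.val ⁻¹' Metric.ball x ε : Set O) := by
  intro y z p q hp hq
  have hy : (y : V) ∈ Metric.ball x ε := hp ⟨0, p.source⟩
  have hz : (z : V) ∈ Metric.ball x ε := hp ⟨1, p.target⟩
  have : ContractibleSpace (Metric.ball x ε) := (convex_ball x ε).contractibleSpace ⟨y, hy⟩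
  let i : C(Metric.ball x ε, O) := ContinuousMap.inclusion h
  let lift (p : Path y z) (hp : range p ⊆ Subtype.val ⁻¹' Metric.ball x ε) :
      Path (⟨y, hy⟩ : Metric.ball x ε) ⟨z, hz⟩ :=
    ⟨⟨fun t => ⟨p t, hp ⟨t, rfl⟩⟩, by fun_prop⟩, Subtype.ext (by simp), Subtype.ext (by simp)⟩
  exact (SimplyConnectedSpace.paths_homotopic (lift p hp) (lift q hq)).map i

theorem exists_simple_nhds {V : Type*} [NormedAddCommGroup V] [NormedSpace ℝ V] {O : Set V}
    (hO : IsOpen O) (x : O) :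
    ∃ U : Set O, IsOpen U ∧ x ∈ U ∧ IsPathConnected U ∧ HomotopicPathsIn U := by
  obtain ⟨ε, hε, hb⟩ := Metric.isOpen_iff.1 hO x x.2
  refine ⟨Subtype.val ⁻¹' Metric.ball (x : V) ε, Metric.isOpen_ball.preimage continuous_subtype_val,
    Metric.mem_ball_self hε, ?_, homotopicPathsIn_ball hb⟩
  rw [Topology.IsInducing.subtypeVal.isPathConnected_iff, Subtype.image_preimage_coe,
    inter_eq_right.2 hb]
  exact (convex_ball _ _).isPathConnected ⟨_, Metric.mem_ball_self hε⟩

theorem isOpen_compl_hypersurface : IsOpen (hypersurface P)ᶜ :=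
  isOpen_ne_fun (contDiff_eval P).continuous continuous_const

theorem pathConnectedSpace_compl_hypersurface (h : (hypersurface P)ᶜ.Nonempty) :
    PathConnectedSpace ((hypersurface P)ᶜ : Set (Fin r → ℂ)) := by
  rw [← isPathConnected_iff_pathConnectedSpace, isPathConnected_iff]
  refine ⟨h, fun a ha b hb => ?_⟩
  exact ((isLinePoly_eval P).joinedIn isOpen_univ convex_univ (mem_univ a) (mem_univ b) ha hb).mono
    inter_subset_right

theorem mem_hypersurface_iff (z : Fin r → ℂ) :
    z ∈ hypersurface P ↔ evalXY (polyInX i₀ P) (Homeomorph.funSplitAt ℂ i₀ z) = 0 := by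
  rw [show evalXY (polyInX i₀ P) (Homeomorph.funSplitAt ℂ i₀ z) = MvPolynomial.eval z P from
    evalXY_polyInX i₀ P z]
  rfl

theorem mem_lineX_diff_iff (y : YIndex i₀ → ℂ) (z : Fin r → ℂ) :
    z ∈ lineX i₀ y \ (lineX i₀ y ∩ hypersurface P) ↔
      (Homeomorph.funSplitAt ℂ i₀ z).2 = y ∧
        evalXY (polyInX i₀ P) (Homeomorph.funSplitAt ℂ i₀ z) ≠ 0 := by
  rw [sdiff_self_inter, mem_sdiff, mem_hypersurface_iff i₀]
  rfl

/-- The complement of the hypersurface in the coordinates `(X, Y)`. -/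
noncomputable def complHomeomorph :
    ((hypersurface P)ᶜ : Set (Fin r → ℂ)) ≃ₜ {x | evalXY (polyInX i₀ P) x ≠ 0} :=
  (Homeomorph.funSplitAt ℂ i₀).subtype fun z => not_congr (mem_hypersurface_iff i₀ P z)

/-- The part of a line of direction `X` off the hypersurface, as a subset of `ℂ`. -/
noncomputable def lineHomeomorph (y : YIndex i₀ → ℂ) :
    (lineX i₀ y \ (lineX i₀ y ∩ hypersurface P) : Set (Fin r → ℂ)) ≃ₜ
      {c : ℂ | evalXY (polyInX i₀ P) (c, y) ≠ 0} where
  toFun a := ⟨(Homeomorph.funSplitAt ℂ i₀ a.1).1, by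
    obtain ⟨h1, h2⟩ := (mem_lineX_diff_iff i₀ P y a.1).1 a.2
    rwa [← Prod.mk.eta (p := Homeomorph.funSplitAt ℂ i₀ a.1), h1] at h2⟩
  invFun c := ⟨(Homeomorph.funSplitAt ℂ i₀).symm (c.1, y), (mem_lineX_diff_iff i₀ P y _).2 <| by
    rw [Homeomorph.apply_symm_apply]
    exact ⟨rfl, c.2⟩⟩
  left_inv a := Subtype.ext <| by
    have h : ((Homeomorph.funSplitAt ℂ i₀ a.1).1, y) = Homeomorph.funSplitAt ℂ i₀ a.1 :=
      Prod.ext rfl ((mem_lineX_diff_iff i₀ P y a.1).1 a.2).1.symm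
    exact (congrArg _ h).trans ((Homeomorph.funSplitAt ℂ i₀).symm_apply_apply a.1)
  right_inv c := Subtype.ext <|
    congrArg Prod.fst ((Homeomorph.funSplitAt ℂ i₀).apply_symm_apply (c.1, y))
  continuous_toFun := by
    refine Continuous.subtype_mk ?_ _
    fun_prop
  continuous_invFun := by
    refine Continuous.subtype_mk ?_ _
    fun_prop

theorem piOneSurjective_complInclusion (hcop : CoeffsCoprime i₀ P) (y : YIndex i₀ → ℂ)
    (hgen : IsGenericLine i₀ P y) :
    PiOneSurjective (complInclusion (lineX i₀ y) (hypersurface P)) := by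
  intro a
  let F := evalXY (polyInX i₀ P)
  have hlo : IsOpen {c : ℂ | F (c, y) ≠ 0} :=
    isOpen_ne_fun ((contDiff_evalXY _).continuous.comp (by fun_prop)) continuous_const
  have hlpc : IsPathConnected {c : ℂ | F (c, y) ≠ 0} := by
    refine isPathConnected_iff.2 ⟨⟨_, (lineHomeomorph i₀ P y a).2⟩, fun b hb c hc => ?_⟩
    have hF : IsLinePoly fun z : ℂ => F (z, y) := by
      intro b v
      obtain ⟨p, hp⟩ := isLinePoly_evalXY (polyInX i₀ P) (b, y) (v, 0)
      exact ⟨p, fun t => by rw [← hp]; simp [F]⟩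
    exact (hF.joinedIn isOpen_univ convex_univ (mem_univ b) (mem_univ c) hb hc).mono
      inter_subset_right
  have := isPathConnected_iff_pathConnectedSpace.1 hlpc
  have := hlo.locallyPathConnectedSpace
  have := (lineHomeomorph i₀ P y).symm.surjective.pathConnectedSpace
    (lineHomeomorph i₀ P y).symm.continuous
  have := (lineHomeomorph i₀ P y).isOpenEmbedding.locallyPathConnectedSpace
  have := pathConnectedSpace_compl_hypersurface P ⟨_, (complInclusion _ _ a).2⟩
  have := (isOpen_compl_hypersurface P).locallyPathConnectedSpace
  refine piOneSurjective_of_sections (exists_simple_nhds (isOpen_compl_hypersurface P)) _ ?_ a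
  intro Y _ π hπ s₀ hs₀
  let e := complHomeomorph i₀ P
  have hπ' : IsCoveringMap (e ∘ π) := hπ.homeomorph_comp e
  have : Nonempty Y := ⟨s₀ a⟩
  classical
  -- The lift over the line becomes a function on the whole product that ignores the second
  -- coordinate; only its values on the fibre over `y` matter, and `s₀ a` is a filler.
  let s : ℂ × (YIndex i₀ → ℂ) → Y := fun x =>
    if hx : F (x.1, y) ≠ 0 then s₀ ((lineHomeomorph i₀ P y).symm ⟨x.1, hx⟩) else s₀ a
  have hs : ∀ c (hc : F (c, y) ≠ 0), s (c, y) = s₀ ((lineHomeomorph i₀ P y).symm ⟨c, hc⟩) :=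
    fun c hc => dif_pos hc
  have htube : ∀ x ∈ tube F {y}, ∃ hc : F (x.1, y) ≠ 0, x = (x.1, y) := by
    rintro ⟨c, _⟩ ⟨rfl, hc⟩
    exact ⟨hc, rfl⟩
  have hsec : IsSectionOn (e ∘ π) s (tube F {y}) := by
    refine ⟨?_, fun x hx => ?_⟩
    · rw [continuousOn_iff_continuous_domRestrict]
      have hc : Continuous fun x : tube F {y} =>
          s₀ ((lineHomeomorph i₀ P y).symm ⟨x.1.1, (htube x x.2).1⟩) := by fun_prop
      exact hc.congr fun x => (hs _ (htube x x.2).1).symm.trans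
        (congrArg s (htube x x.2).2.symm)
    · obtain ⟨hc, hxy⟩ := htube x hx
      rw [hxy, hs x.1 hc, Function.comp_apply, hs₀]
      exact (Homeomorph.funSplitAt ℂ i₀).apply_symm_apply (x.1, y)
  obtain ⟨t, ht, hts⟩ := exists_extend_section_evalXY (polyInX i₀ P) hcop hπ' y hgen hsec
  refine ⟨⟨fun x => t (e x), ht.1.comp_continuous (by fun_prop) fun x => (e x).2⟩, fun x => ?_,
    fun b => ?_⟩
  · exact e.injective (Subtype.ext (ht.2 _ (e x).2))
  · obtain ⟨c, rfl⟩ := (lineHomeomorph i₀ P y).symm.surjective b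
    have hec : (e (complInclusion _ _ ((lineHomeomorph i₀ P y).symm c)) : ℂ × _) = (c.1, y) :=
      (Homeomorph.funSplitAt ℂ i₀).apply_symm_apply (c.1, y)
    change t (e _) = _
    rw [hec, hts ⟨rfl, c.2⟩, hs c.1 c.2]

end Transport

end ZariskiPi1

/-- The inclusion of a generic line minus the hypersurface is `π₁`-surjective. A generic line can
only exist when `P` is squarefree up to factors free of `X`, so `hP` follows from the other
hypotheses. -/
theorem mainTheorem2 {r : ℕ} (P : MvPolynomial (Fin r) ℂ) (hP : Squarefree P) (i₀ : Fin r)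
    (hcop : ZariskiPi1.CoeffsCoprime i₀ P) (y : ZariskiPi1.YIndex i₀ → ℂ)
    (hgen : ZariskiPi1.IsGenericLine i₀ P y) :
    ZariskiPi1.PiOneSurjective
      (ZariskiPi1.complInclusion (ZariskiPi1.lineX i₀ y) (ZariskiPi1.hypersurface P)) :=
  ZariskiPi1.piOneSurjective_complInclusion i₀ P hcop y hgen
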